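/- Let $\omega=-\tfrac12+\tfrac{\sqrt3}{2}i$. For each $n\in\mathbb N$ let $q=q_n$ be a prime with $q\equiv 1\pmod 3$, let $k=k_n\ge 0$ be an integer, let $\varrho=\varrho_n\in\mathbb Z[\omega]$ satisfy $|\varrho|^2=q$, and let $\sigma=\sigma_n:\mathbb Z[\omega]/\varrho\mathbb Z[\omega]\to\mathbb F_q$ be a ring isomorphism; write $\tilde\sigma:\mathbb Z[\omega]\to\mathbb F_q$ for reduction modulo $\varrho$ followed by $\sigma$, applied componentwise to vectors. A lattice drawn from the $(n,k,q,\mathbb Z[\omega])$ Construction-A ensemble is $$\Lambda=\varrho^{-1}\{\lambda\in\mathbb Z[\omega]^n:\ \tilde\sigma(\lambda)\in \mathbf G\,\mathbb F_q^k\}\subset\mathbb C^n\cong\mathbb R^{2n},$$ where $\mathbf G\in\mathbb F_q^{n\times k}$ has i.i.d. entries uniformly distributed over $\mathbb F_q$. Let $r^{\mathrm{cov}}_\Lambda$ be its covering radius (the smallest $r\ge 0$ such that the closed balls of radius $r$ centred at the points of $\Lambda$ cover $\mathbb C^n$) and $r^{\mathrm{eff}}_\Lambda$ its effective radius (the radius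 of the ball in $\mathbb R^{2n}$ whose volume is that of the fundamental Voronoi region of $\Lambda$). Let $V_{\mathcal B}(r)=\pi^n r^{2n}/\Gamma(n+1)$ be the volume of the ball of radius $r$ in $\mathbb R^{2n}$. Suppose that (a) there is a constant $\beta<1$ with $k_n\le\beta n$ for all large $n$, and $\log^2 n=o(k_n)$ as $n\to\infty$; (b) there are a constant $r_{\min}$ with $0<r_{\min}<\tfrac14$ and real numbers $r_n$ such that, for all large $n$, $$q_n^{k_n}=\frac{(\sqrt3/2)^n}{V_{\mathcal B}(r_n)}\qquad\text{and}\qquad r_{\min}<r_n<2r_{\min}.$$ (Thus $r_n$ is the effective radius of $\Lambda$ whenever $\mathbf G$ has full rank $k_n$.) Then $\Lambda$ is good for covering: $r^{\mathrm{cov}}_\Lambda/r^{\mathrm{eff}}_\Lambda\to1$ in probability as $n\to\infty$, i.e. for every $\varepsilon>0$, $$\Pr\left\{\left|\frac{r^{\mathrm{cov}}_\Lambda}{r^{\mathrm{eff}}_\Lambda}-1\right|\ge\varepsilon\right\}\to0 .$$ -/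

import Mathlib

open Filter Topology MeasureTheory

/-- The primitive cube root of unity `ω = -1/2 + (√3/2) i`. -/
noncomputable def eisensteinOmega : ℂ := -(1 / 2) + (Real.sqrt 3 / 2 : ℝ) * Complex.I

theorem eisensteinOmega_sq : eisensteinOmega ^ 2 = -1 - eisensteinOmega := by
  have h3 : ((Real.sqrt 3 : ℝ) : ℂ) ^ 2 = 3 := by
    rw [← Complex.ofReal_pow, Real.sq_sqrt (by norm_num)]; norm_num
  unfold eisensteinOmega
  push_cast
  linear_combination (1 / 4 : ℂ) * Complex.I ^ 2 * h3 + (3 / 4 : ℂ) * Complex.I_sq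

/-- The ring `ℤ[ω]` of Eisenstein integers: the complex numbers `a + b ω` with `a b : ℤ`. -/
noncomputable def EisensteinInt : Subring ℂ where
  carrier := {z | ∃ a b : ℤ, z = a + b * eisensteinOmega}
  zero_mem' := ⟨0, 0, by simp⟩
  one_mem' := ⟨1, 0, by simp⟩
  add_mem' := by
    rintro _ _ ⟨a, b, rfl⟩ ⟨c, d, rfl⟩
    exact ⟨a + c, b + d, by push_cast; ring⟩
  neg_mem' := by
    rintro _ ⟨a, b, rfl⟩
    exact ⟨-a, -b, by push_cast; ring⟩
  mul_mem' := by
    rintro _ _ ⟨a, b, rfl⟩ ⟨c, d, rfl⟩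
    refine ⟨a * c - b * d, a * d + b * c - b * d, ?_⟩
    push_cast
    linear_combination ((b : ℂ) * d) * eisensteinOmega_sq

/-- The linear code `{G y : y ∈ 𝔽_q^k} ⊆ 𝔽_q^n` generated by the columns of `G`. -/
def columnCode {n k q : ℕ} (G : Matrix (Fin n) (Fin k) (ZMod q)) :
    Submodule (ZMod q) (Fin n → ZMod q) :=
  LinearMap.range G.mulVecLin

/-- The labelling `ℤ[ω] → ℤ[ω]/ϱℤ[ω] ≅ 𝔽_q`: reduction modulo `ϱ` followed by `σ`. -/
noncomputable def labelling {q : ℕ} {ϱ : EisensteinInt}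
    (σ : (EisensteinInt ⧸ Ideal.span {ϱ}) ≃+* ZMod q) : EisensteinInt →+* ZMod q :=
  (σ : (EisensteinInt ⧸ Ideal.span {ϱ}) →+* ZMod q).comp (Ideal.Quotient.mk (Ideal.span {ϱ}))

/-- Construction A over `ℤ[ω]`: the `ℤ[ω]`-submodule
`ϱ⁻¹ {u ∈ ℤ[ω]^n : (labels of the coordinates of u) ∈ C}` of `ℂ^n`, with `C` generated by `G`. -/
noncomputable def constructionA {n k q : ℕ} (ϱ : EisensteinInt)
    (σ : (EisensteinInt ⧸ Ideal.span {ϱ}) ≃+* ZMod q)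
    (G : Matrix (Fin n) (Fin k) (ZMod q)) :
    Submodule EisensteinInt (EuclideanSpace ℂ (Fin n)) where
  carrier := {x | ∃ u : Fin n → EisensteinInt,
    (fun i => labelling σ (u i)) ∈ columnCode G ∧ ∀ i, x i = (ϱ : ℂ)⁻¹ * (u i : ℂ)}
  zero_mem' := by
    refine ⟨0, ?_, by simp⟩
    convert (columnCode G).zero_mem using 1
    funext i
    simp
  add_mem' := by
    rintro x y ⟨u, hu, hx⟩ ⟨v, hv, hy⟩
    refine ⟨u + v, ?_, fun i => ?_⟩
    · have h := (columnCode G).add_mem hu hv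
      convert h using 1
      funext i
      simp
    · simp [hx i, hy i, mul_add]
  smul_mem' := by
    rintro c x ⟨u, hu, hx⟩
    refine ⟨fun i => c * u i, ?_, fun i => ?_⟩
    · have h := (columnCode G).smul_mem (labelling σ c) hu
      convert h using 1
      funext i
      simp
    · have h : (c • x) i = (c : ℂ) * x i := rfl
      rw [h, hx i]
      push_cast
      ring

/-- The law of the entries of the generator matrix of the `(n, k, q, ℤ[ω])` ensemble: the entries
are i.i.d. and uniformly distributed over `𝔽_q`. -/
noncomputable def generatorLaw (n k q : ℕ) : Measure (Fin n → Fin k → ZMod q) :=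
  Measure.pi fun _ => Measure.pi fun _ => ProbabilityTheory.uniformOn Set.univ

/-- The covering radius of `L ⊆ ℂ^n`: the smallest `r ≥ 0` such that the closed balls of radius `r`
centred at the points of `L` cover the space. -/
noncomputable def coveringRadius {n : ℕ} (L : Set (EuclideanSpace ℂ (Fin n))) : ℝ :=
  sInf {r : ℝ | 0 ≤ r ∧ ∀ x, ∃ y ∈ L, dist x y ≤ r}

/-- The fundamental Voronoi region of `L ⊆ ℂ^n`: the points that are at least as close to the origin
as to any other point of `L`. -/
def voronoiRegion {n : ℕ} (L : Set (EuclideanSpace ℂ (Fin n))) :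
    Set (EuclideanSpace ℂ (Fin n)) :=
  {x | ∀ y ∈ L, ‖x‖ ≤ ‖x - y‖}

/-- The volume of the ball of radius `r` in `ℂ^n = ℝ^{2n}`. -/
noncomputable def ballVolume (n : ℕ) (r : ℝ) : ℝ :=
  (volume (Metric.closedBall (0 : EuclideanSpace ℂ (Fin n)) r)).toReal

/-- The effective radius of a lattice `L` in `ℂ^n = ℝ^{2n}`: the radius of the ball whose volume
is that of the fundamental Voronoi region of `L`. -/
noncomputable def effectiveRadius {n : ℕ} (L : Set (EuclideanSpace ℂ (Fin n))) : ℝ :=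
  ((volume (voronoiRegion L)).toReal / ballVolume n 1) ^ (1 / (2 * (n : ℝ)))

/-! Every `Λ` has covolume at least that of a ball of radius `r`, a rank drop only increasing it, so
`r ≤ r^eff ≤ r^cov`. It remains to show `r^cov ≤ (1 + 2η) r` with high probability.

This reduces to a finite covering problem. Let `S ⊆ 𝔽_q^n` be the labels of Eisenstein vectors of
norm at most `R = √q (1 + η) r + 2√n`. If `C + S = 𝔽_q^n` for the code `C`, then balls of radius `(R
+ 2√n)/√q` about `Λ` cover `ℂ^n`. Since `k ≤ βn` makes `q` grow faster than `n`, the rounding terms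
are negligible. Labels are injective on the ball because `r < 1/2` with room to spare, so
`ballVolume_le_ncard_labelBall` gives `q^k |S| ≥ (1 + η)^{2n} q^n`.

The random code is treated in two phases, with `k = m + t`. For the first `m` columns, pairwise
independence and a second-moment bound (`sum_card_uncovered_mul_le`) give a mean uncovered fraction
of at most `q^n / (q^m |S|)`. Each of the other `t` columns squares that fraction on average
(`sum_card_uncovered_cons_le`), so `t = O(log n)` columns bring it below `q^{-n}`, that is, to zero.
Reserving these columns costs a factor `q^t`, which is at most `(1 + η)^n` precisely because `log² n
= o(k)`. -/

/-! ### Lebesgue measure on `ℂ^n`. -/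

/-- Currying preserves the product Lebesgue measure. -/
theorem measurePreserving_sigmaUncurry_real {n : ℕ} :
    MeasurePreserving (MeasurableEquiv.piCurry (fun (_ : Fin n) (_ : Fin 2) => ℝ)).symm
      volume volume := by
  refine ⟨(MeasurableEquiv.piCurry _).symm.measurable, ?_⟩
  refine (Measure.pi_eq fun s hs => ?_).symm
  rw [Measure.map_apply (MeasurableEquiv.piCurry _).symm.measurable (MeasurableSet.univ_pi hs)]
  have : (MeasurableEquiv.piCurry (fun (_ : Fin n) (_ : Fin 2) => ℝ)).symm ⁻¹' (Set.univ.pi s)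
      = Set.univ.pi fun i => Set.univ.pi fun j => s ⟨i, j⟩ := by
    ext f
    simp only [Set.mem_preimage, Set.mem_univ_pi, MeasurableEquiv.coe_piCurry_symm]
    exact ⟨fun h i j => h ⟨i, j⟩, fun h p => h p.1 p.2⟩
  rw [this, volume_pi_pi]
  simp_rw [volume_pi_pi]
  rw [Fintype.prod_sigma]

/-- The identification of the Euclidean space `ℂ^n` with a product of copies of `ℂ` preserves
volume. -/
theorem measurePreserving_ofLp_complex (n : ℕ) :
    MeasurePreserving (fun x : EuclideanSpace ℂ (Fin n) => (x.ofLp : Fin n → ℂ))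
      volume volume := by
  have h1 := (Pi.orthonormalBasis (𝕜 := ℝ)
    (fun _ : Fin n => Complex.orthonormalBasisOneI)).measurePreserving_repr
  have h2 := PiLp.volume_preserving_ofLp (Σ _ : Fin n, Fin 2)
  have h3 := (measurePreserving_sigmaUncurry_real (n := n)).symm
  have h4 := volume_preserving_pi (fun _ : Fin n => Complex.volume_preserving_equiv_pi.symm)
  have h := h4.comp (h3.comp (h2.comp h1))
  suffices hf : (fun x : EuclideanSpace ℂ (Fin n) => (x.ofLp : Fin n → ℂ)) = _ from hf ▸ h
  funext x
  funext i
  apply Complex.measurableEquivPi.injective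
  simp only [Function.comp_apply, MeasurableEquiv.apply_symm_apply]
  funext j
  change ![(x i).re, (x i).im] j = (Complex.orthonormalBasisOneI.repr (x i)) j
  rw [Complex.orthonormalBasisOneI_repr_apply]

/-! ### The Eisenstein lattice in the plane. -/

/-- The half-open fundamental parallelogram of `ℤ[ω]` spanned by `1` and `ω`. -/
def eisensteinCell : Set ℂ :=
  {z | z.re + z.im / √3 ∈ Set.Ico (0 : ℝ) 1 ∧ 2 * z.im / √3 ∈ Set.Ico (0 : ℝ) 1}

theorem measurableSet_eisensteinCell : MeasurableSet eisensteinCell := by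
  have h1 : Measurable fun z : ℂ => z.re + z.im / √3 := by fun_prop
  have h2 : Measurable fun z : ℂ => 2 * z.im / √3 := by fun_prop
  exact (h1 measurableSet_Ico).inter (h2 measurableSet_Ico)

theorem volume_eisensteinCell : volume eisensteinCell = ENNReal.ofReal (√3 / 2) := by
  -- `L` reads off the coordinates in the basis `1, ω`, so the cell is the preimage of the unit
  -- square.
  let L : ℂ →ₗ[ℝ] ℂ :=
    Matrix.toLin Complex.basisOneI Complex.basisOneI !![1, 1 / √3; 0, 2 / √3]
  have hL : ∀ z, L z = ⟨z.re + z.im / √3, 2 * z.im / √3⟩ := by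
    intro z
    simp only [L, Matrix.toLin_apply, Fin.sum_univ_two, Matrix.mulVec, dotProduct]
    have h3 : √3 * √3 = 3 := Real.mul_self_sqrt (by norm_num)
    apply Complex.ext
    · simp
      field_simp
      linear_combination z.im * h3
    · simp
      field_simp
  have hdet : LinearMap.det L = 2 / √3 := by
    simp [L, LinearMap.det_toLin, Matrix.det_fin_two]
  have h3 : (0 : ℝ) < √3 := by positivity
  have hcell : eisensteinCell = L ⁻¹' (Complex.measurableEquivRealProd ⁻¹'
      (Set.Ico (0 : ℝ) 1 ×ˢ Set.Ico (0 : ℝ) 1)) := by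
    ext z
    simp only [eisensteinCell, Set.mem_ofPred_eq, Set.mem_preimage, hL,
      Complex.measurableEquivRealProd_apply, Set.mem_prod]
  have hprod : (volume : Measure (ℝ × ℝ)) (Set.Ico (0 : ℝ) 1 ×ˢ Set.Ico (0 : ℝ) 1) = 1 := by
    rw [Measure.volume_eq_prod, Measure.prod_prod]; simp
  rw [hcell, Measure.addHaar_preimage_linearMap _ (by rw [hdet]; positivity),
    Complex.volume_preserving_equiv_real_prod.measure_preimage_equiv, hprod, hdet, mul_one,
    abs_of_pos (by positivity), inv_div]

theorem norm_le_two_of_mem_eisensteinCell {z : ℂ} (hz : z ∈ eisensteinCell) : ‖z‖ ≤ 2 := by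
  obtain ⟨⟨h1, h2⟩, h3, h4⟩ := hz
  have hs : (0 : ℝ) < √3 := by positivity
  have hsq : √3 ^ 2 = 3 := Real.sq_sqrt (by norm_num)
  set t := z.im / √3 with ht
  have him : z.im = t * √3 := by rw [ht]; field_simp
  have h5 : 2 * z.im / √3 = 2 * t := by rw [ht]; ring
  rw [h5] at h3 h4
  rw [← sq_le_sq₀ (norm_nonneg _) (by norm_num), Complex.sq_norm, Complex.normSq_apply, him]
  have : t * √3 * (t * √3) = 3 * t ^ 2 := by
    linear_combination t ^ 2 * hsq
  rw [this]
  nlinarith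

theorem eisensteinOmega_re : eisensteinOmega.re = -(1 / 2) := by
  simp [eisensteinOmega]

theorem eisensteinOmega_im : eisensteinOmega.im = √3 / 2 := by
  simp [eisensteinOmega]

theorem EisensteinInt.exists_eq (u : EisensteinInt) :
    ∃ a b : ℤ, (u : ℂ) = a + b * eisensteinOmega := u.2

theorem sq_norm_intCast_add_mul_eisensteinOmega (a b : ℤ) :
    ‖(a + b * eisensteinOmega : ℂ)‖ ^ 2 = ((a ^ 2 - a * b + b ^ 2 : ℤ) : ℝ) := by
  have hsq : √3 ^ 2 = 3 := Real.sq_sqrt (by norm_num)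
  rw [Complex.sq_norm, Complex.normSq_apply]
  simp [eisensteinOmega_re, eisensteinOmega_im]
  linear_combination (b ^ 2 / 4 : ℝ) * hsq

/-- The squared norm is the value of the positive definite integral form `a² - ab + b²`. -/
theorem EisensteinInt.eq_zero_of_norm_lt_one {u : EisensteinInt} (h : ‖(u : ℂ)‖ < 1) : u = 0 := by
  obtain ⟨a, b, hab⟩ := EisensteinInt.exists_eq u
  have h1 : ‖(u : ℂ)‖ ^ 2 < 1 := by
    have := norm_nonneg (u : ℂ); nlinarith
  rw [hab, sq_norm_intCast_add_mul_eisensteinOmega] at h1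
  have h2 : a ^ 2 - a * b + b ^ 2 < 1 := by exact_mod_cast h1
  have hb : b = 0 := by
    by_contra hb
    have : 1 ≤ b ^ 2 := by have := sq_pos_of_ne_zero hb; omega
    nlinarith [sq_nonneg (2 * a - b)]
  subst hb
  have ha : a = 0 := by
    by_contra ha
    have : 1 ≤ a ^ 2 := by have := sq_pos_of_ne_zero ha; omega
    nlinarith
  subst ha
  apply Subtype.ext
  simpa using hab

/-- The coordinatewise lower corner of the translate of the fundamental parallelogram
that contains `z`. -/
theorem exists_sub_mem_eisensteinCell (z : ℂ) : ∃ u : EisensteinInt, z - u ∈ eisensteinCell := by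
  have hs : (√3 : ℝ) ≠ 0 := by positivity
  refine ⟨⟨⌊z.re + z.im / √3⌋ + ⌊2 * z.im / √3⌋ * eisensteinOmega, _, _, rfl⟩, ?_⟩
  have e1 : ∀ a b : ℤ, (z - (a + b * eisensteinOmega)).re + (z - (a + b * eisensteinOmega)).im / √3
      = z.re + z.im / √3 - a := by
    intro a b
    simp [eisensteinOmega_re, eisensteinOmega_im]
    field_simp
    ring
  have e2 : ∀ a b : ℤ, 2 * (z - (a + b * eisensteinOmega)).im / √3 = 2 * z.im / √3 - b := by
    intro a b
    simp [eisensteinOmega_im]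
    field_simp
  refine ⟨?_, ?_⟩
  · rw [e1]
    exact ⟨by linarith [Int.floor_le (z.re + z.im / √3)],
      by linarith [Int.lt_floor_add_one (z.re + z.im / √3)]⟩
  · rw [e2]
    exact ⟨by linarith [Int.floor_le (2 * z.im / √3)],
      by linarith [Int.lt_floor_add_one (2 * z.im / √3)]⟩

theorem eq_of_sub_mem_eisensteinCell {z : ℂ} {u v : EisensteinInt} (hu : z - u ∈ eisensteinCell)
    (hv : z - v ∈ eisensteinCell) : u = v := by
  have hs : (√3 : ℝ) ≠ 0 := by positivity
  obtain ⟨a, b, hab⟩ := EisensteinInt.exists_eq u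
  obtain ⟨c, d, hcd⟩ := EisensteinInt.exists_eq v
  have e1 : ∀ a b : ℤ, (z - (a + b * eisensteinOmega)).re + (z - (a + b * eisensteinOmega)).im / √3
      = z.re + z.im / √3 - a := by
    intro a b
    simp [eisensteinOmega_re, eisensteinOmega_im]
    field_simp
    ring
  have e2 : ∀ a b : ℤ, 2 * (z - (a + b * eisensteinOmega)).im / √3 = 2 * z.im / √3 - b := by
    intro a b
    simp [eisensteinOmega_im]
    field_simp
  rw [hab] at hu
  rw [hcd] at hv
  obtain ⟨⟨h1, h2⟩, h3, h4⟩ := hu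
  obtain ⟨⟨h5, h6⟩, h7, h8⟩ := hv
  rw [e1] at h1 h2 h5 h6
  rw [e2] at h3 h4 h7 h8
  have hac : a = c := by
    have i1 : (a : ℝ) < c + 1 := by linarith
    have i2 : (c : ℝ) < a + 1 := by linarith
    have i1' : a < c + 1 := by exact_mod_cast i1
    have i2' : c < a + 1 := by exact_mod_cast i2
    omega
  have hbd : b = d := by
    have i1 : (b : ℝ) < d + 1 := by linarith
    have i2 : (d : ℝ) < b + 1 := by linarith
    have i1' : b < d + 1 := by exact_mod_cast i1
    have i2' : d < b + 1 := by exact_mod_cast i2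
    omega
  apply Subtype.ext
  rw [hab, hcd, hac, hbd]

/-! ### The lattice `ℤ[ω]^n` and ball volumes. -/

/-- The fundamental parallelotope of `ℤ[ω]^n`. -/
def eisensteinBox (n : ℕ) : Set (EuclideanSpace ℂ (Fin n)) := {x | ∀ i, x i ∈ eisensteinCell}

theorem eisensteinBox_eq_preimage (n : ℕ) : eisensteinBox n =
    (fun x : EuclideanSpace ℂ (Fin n) => (x.ofLp : Fin n → ℂ)) ⁻¹'
      (Set.univ.pi fun _ => eisensteinCell) := by
  ext x; simp [eisensteinBox]

theorem measurableSet_eisensteinBox (n : ℕ) : MeasurableSet (eisensteinBox n) := by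
  rw [eisensteinBox_eq_preimage]
  exact (measurePreserving_ofLp_complex n).measurable
    (MeasurableSet.univ_pi fun _ => measurableSet_eisensteinCell)

theorem volume_eisensteinBox (n : ℕ) :
    volume (eisensteinBox n) = ENNReal.ofReal ((√3 / 2) ^ n) := by
  rw [eisensteinBox_eq_preimage, (measurePreserving_ofLp_complex n).measure_preimage
    (MeasurableSet.univ_pi fun _ => measurableSet_eisensteinCell).nullMeasurableSet, volume_pi_pi]
  rw [ENNReal.ofReal_pow (by positivity)]
  simp [volume_eisensteinCell]

theorem norm_le_of_forall_norm_le {n : ℕ} {x : EuclideanSpace ℂ (Fin n)} {c : ℝ} (hc : 0 ≤ c)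
    (h : ∀ i, ‖x i‖ ≤ c) : ‖x‖ ≤ c * √n := by
  rw [EuclideanSpace.norm_eq]
  have : ∑ i, ‖x i‖ ^ 2 ≤ c ^ 2 * n := by
    calc ∑ i, ‖x i‖ ^ 2 ≤ ∑ _i : Fin n, c ^ 2 :=
          Finset.sum_le_sum fun i _ => by have := norm_nonneg (x i); gcongr; exact h i
      _ = c ^ 2 * n := by simp [mul_comm]
  calc √(∑ i, ‖x i‖ ^ 2) ≤ √(c ^ 2 * n) := Real.sqrt_le_sqrt this
    _ = c * √n := by rw [Real.sqrt_mul (by positivity), Real.sqrt_sq hc]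

/-- The vector of `ℂ^n` with the given Eisenstein coordinates. -/
def eisensteinVec {n : ℕ} (u : Fin n → EisensteinInt) : EuclideanSpace ℂ (Fin n) :=
  WithLp.toLp 2 fun i => (u i : ℂ)

@[simp] theorem eisensteinVec_apply {n : ℕ} (u : Fin n → EisensteinInt) (i : Fin n) :
    eisensteinVec u i = u i := rfl

theorem eisensteinVec_sub {n : ℕ} (u v : Fin n → EisensteinInt) :
    eisensteinVec (u - v) = eisensteinVec u - eisensteinVec v := by
  ext i; simp

theorem exists_sub_mem_eisensteinBox {n : ℕ} (x : EuclideanSpace ℂ (Fin n)) :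
    ∃ u : Fin n → EisensteinInt, x - eisensteinVec u ∈ eisensteinBox n := by
  choose u hu using fun i => exists_sub_mem_eisensteinCell (x i)
  exact ⟨u, hu⟩

theorem eq_of_sub_mem_eisensteinBox {n : ℕ} {x : EuclideanSpace ℂ (Fin n)}
    {u v : Fin n → EisensteinInt} (hu : x - eisensteinVec u ∈ eisensteinBox n)
    (hv : x - eisensteinVec v ∈ eisensteinBox n) : u = v :=
  funext fun i => eq_of_sub_mem_eisensteinCell (hu i) (hv i)

theorem norm_le_of_mem_eisensteinBox {n : ℕ} {x : EuclideanSpace ℂ (Fin n)}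
    (hx : x ∈ eisensteinBox n) : ‖x‖ ≤ 2 * √n :=
  norm_le_of_forall_norm_le (by norm_num) fun i => norm_le_two_of_mem_eisensteinCell (hx i)

theorem finrank_real_euclideanSpace_complex (n : ℕ) :
    Module.finrank ℝ (EuclideanSpace ℂ (Fin n)) = 2 * n := by
  rw [← Module.finrank_mul_finrank ℝ ℂ (EuclideanSpace ℂ (Fin n)), Complex.finrank_real_complex,
    finrank_euclideanSpace_fin]

theorem ballVolume_eq {n : ℕ} (hn : 0 < n) {r : ℝ} (hr : 0 ≤ r) :
    ballVolume n r = r ^ (2 * n) * (Real.pi ^ n / n.factorial) := by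
  have : Nonempty (Fin n) := ⟨⟨0, hn⟩⟩
  have : Nontrivial (EuclideanSpace ℂ (Fin n)) := inferInstance
  rw [ballVolume, InnerProductSpace.volume_closedBall_of_dim_even
    (finrank_real_euclideanSpace_complex n), finrank_real_euclideanSpace_complex,
    ENNReal.toReal_mul, ENNReal.toReal_pow, ENNReal.toReal_ofReal hr,
    ENNReal.toReal_ofReal (by positivity)]

theorem ballVolume_one_pos {n : ℕ} (hn : 0 < n) : 0 < ballVolume n 1 := by
  rw [ballVolume_eq hn zero_le_one]; positivity

theorem ballVolume_mul {n : ℕ} (hn : 0 < n) {a r : ℝ} (ha : 0 ≤ a) (hr : 0 ≤ r) :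
    ballVolume n (a * r) = a ^ (2 * n) * ballVolume n r := by
  rw [ballVolume_eq hn (mul_nonneg ha hr), ballVolume_eq hn hr]; ring

instance : Countable EisensteinInt := by
  have : Function.Surjective fun p : ℤ × ℤ =>
      (⟨p.1 + p.2 * eisensteinOmega, p.1, p.2, rfl⟩ : EisensteinInt) := by
    intro u
    obtain ⟨a, b, h⟩ := EisensteinInt.exists_eq u
    exact ⟨(a, b), Subtype.ext h.symm⟩
  exact this.countable

theorem EisensteinInt.finite_setOf_norm_le (R : ℝ) :
    {u : EisensteinInt | ‖(u : ℂ)‖ ≤ R}.Finite := by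
  obtain ⟨N, hN⟩ := exists_nat_gt (2 * R ^ 2)
  refine (((Set.finite_Icc (-(N : ℤ)) N).prod (Set.finite_Icc (-(N : ℤ)) N)).image
    fun p : ℤ × ℤ => (⟨p.1 + p.2 * eisensteinOmega, p.1, p.2, rfl⟩ : EisensteinInt)).subset ?_
  intro u hu
  obtain ⟨a, b, h⟩ := EisensteinInt.exists_eq u
  have h0 : ‖(u : ℂ)‖ ≤ R := hu
  have h1 : ‖(u : ℂ)‖ ^ 2 ≤ R ^ 2 := by
    have := norm_nonneg (u : ℂ); gcongr
  rw [h, sq_norm_intCast_add_mul_eisensteinOmega] at h1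
  have h2 : 2 * (a ^ 2 - a * b + b ^ 2) < (N : ℤ) := by
    have : 2 * ((a ^ 2 - a * b + b ^ 2 : ℤ) : ℝ) < N := by linarith
    exact_mod_cast this
  -- Since `2(a² - ab + b²) = a² + b² + (a - b)²`, the norm bounds both coordinates.
  have ha : a ^ 2 ≤ N := by nlinarith [sq_nonneg (a - b)]
  have hb : b ^ 2 ≤ N := by nlinarith [sq_nonneg (a - b)]
  have key : ∀ c : ℤ, c ^ 2 ≤ N → c ∈ Set.Icc (-(N : ℤ)) N := by
    intro c hc
    have h3 : c ^ 2 ≤ (N : ℤ) ^ 2 :=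
      hc.trans (by exact_mod_cast Nat.le_self_pow two_ne_zero N)
    exact abs_le_of_sq_le_sq' h3 (by positivity)
  exact ⟨(a, b), ⟨key a ha, key b hb⟩, Subtype.ext h.symm⟩

theorem finite_setOf_norm_eisensteinVec_le (n : ℕ) (R : ℝ) :
    {u : Fin n → EisensteinInt | ‖eisensteinVec u‖ ≤ R}.Finite := by
  refine (Set.Finite.pi fun _ : Fin n => EisensteinInt.finite_setOf_norm_le R).subset ?_
  intro u hu i _
  exact (PiLp.norm_apply_le (eisensteinVec u) i).trans hu

/-! ### From coverings of `𝔽_q^n` to coverings of `ℂ^n`. -/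

section ConstructionA

variable {n k q : ℕ} {ϱ : EisensteinInt} {σ : (EisensteinInt ⧸ Ideal.span {ϱ}) ≃+* ZMod q}

theorem labelling_surjective : Function.Surjective (labelling σ) :=
  σ.surjective.comp Ideal.Quotient.mk_surjective

theorem labelling_eq_zero_iff {u : EisensteinInt} : labelling σ u = 0 ↔ ∃ z, u = ϱ * z := by
  have : labelling σ u = σ (Ideal.Quotient.mk (Ideal.span {ϱ}) u) := rfl
  rw [this, map_eq_zero_iff σ σ.injective, Ideal.Quotient.eq_zero_iff_mem,
    Ideal.mem_span_singleton]
  rfl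

theorem exists_eq_mul_of_labelling_eq {u v : Fin n → EisensteinInt}
    (h : ∀ i, labelling σ (u i) = labelling σ (v i)) :
    ∃ z : Fin n → EisensteinInt, ∀ i, u i - v i = ϱ * z i := by
  have : ∀ i, ∃ z, u i - v i = ϱ * z := fun i =>
    labelling_eq_zero_iff (σ := σ).mp (by rw [map_sub, h i, sub_self])
  choose z hz using this
  exact ⟨z, hz⟩

theorem mem_constructionA_iff {G : Matrix (Fin n) (Fin k) (ZMod q)}
    {x : EuclideanSpace ℂ (Fin n)} :
    x ∈ constructionA ϱ σ G ↔ ∃ u : Fin n → EisensteinInt,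
      (fun i => labelling σ (u i)) ∈ columnCode G ∧ x = (ϱ : ℂ)⁻¹ • eisensteinVec u := by
  constructor
  · rintro ⟨u, hu, hx⟩
    exact ⟨u, hu, by ext i; simp [hx i]⟩
  · rintro ⟨u, hu, rfl⟩
    exact ⟨u, hu, fun i => by simp⟩

theorem smul_eisensteinVec_eq (hϱ : (ϱ : ℂ) ≠ 0) {u v z : Fin n → EisensteinInt}
    (h : ∀ i, u i - v i = ϱ * z i) :
    (ϱ : ℂ)⁻¹ • eisensteinVec u = (ϱ : ℂ)⁻¹ • eisensteinVec v + eisensteinVec z := by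
  ext i
  have h1 : (u i : ℂ) - v i = ϱ * z i := by exact_mod_cast congrArg Subtype.val (h i)
  simp only [PiLp.smul_apply, PiLp.add_apply, eisensteinVec_apply, smul_eq_mul]
  field_simp
  linear_combination h1

/-- Containing `ℤ[ω]^n` whatever `G` is, the lattice always has a finite covering radius. -/
theorem eisensteinVec_mem_constructionA (hϱ : (ϱ : ℂ) ≠ 0) (G : Matrix (Fin n) (Fin k) (ZMod q))
    (z : Fin n → EisensteinInt) : eisensteinVec z ∈ constructionA ϱ σ G := by
  rw [mem_constructionA_iff]
  refine ⟨fun i => ϱ * z i, ?_, ?_⟩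
  · have : (fun i => labelling σ (ϱ * z i)) = (0 : Fin n → ZMod q) :=
      funext fun i => labelling_eq_zero_iff.mpr ⟨z i, rfl⟩
    rw [this]
    exact (columnCode G).zero_mem
  · have := smul_eisensteinVec_eq hϱ (u := fun i => ϱ * z i) (v := 0) (z := z) (by simp)
    rw [this]
    ext i; simp

/-- Labels of the Eisenstein vectors of norm at most `R`. -/
def labelBall (n : ℕ) (σ : (EisensteinInt ⧸ Ideal.span {ϱ}) ≃+* ZMod q) (R : ℝ) :
    Set (Fin n → ZMod q) :=
  {s | ∃ u : Fin n → EisensteinInt, (fun i => labelling σ (u i)) = s ∧ ‖eisensteinVec u‖ ≤ R}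

/-- Coordinates with equal labels differ by a multiple of `ϱ`, and here the difference is shorter
than `ϱ`. -/
theorem eq_of_labelling_eq_of_norm_le (hϱ : (ϱ : ℂ) ≠ 0) {R : ℝ} (hR : 2 * R < ‖(ϱ : ℂ)‖)
    {u v : Fin n → EisensteinInt} (h : ∀ i, labelling σ (u i) = labelling σ (v i))
    (hu : ‖eisensteinVec u‖ ≤ R) (hv : ‖eisensteinVec v‖ ≤ R) : u = v := by
  obtain ⟨z, hz⟩ := exists_eq_mul_of_labelling_eq h
  funext i
  have h0 : 0 < ‖(ϱ : ℂ)‖ := norm_pos_iff.mpr hϱ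
  have h1 : ((u i : ℂ) - v i) = ϱ * z i := by exact_mod_cast congrArg Subtype.val (hz i)
  have h2 : ‖(u i : ℂ)‖ ≤ R := (PiLp.norm_apply_le (eisensteinVec u) i).trans hu
  have h3 : ‖(v i : ℂ)‖ ≤ R := (PiLp.norm_apply_le (eisensteinVec v) i).trans hv
  have h4 : ‖(ϱ : ℂ)‖ * ‖(z i : ℂ)‖ < ‖(ϱ : ℂ)‖ * 1 := by
    rw [← norm_mul, ← h1]
    linarith [norm_sub_le (u i : ℂ) (v i)]
  have h5 := EisensteinInt.eq_zero_of_norm_lt_one (lt_of_mul_lt_mul_left h4 h0.le)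
  have h6 := hz i
  rw [h5, mul_zero] at h6
  exact sub_eq_zero.mp h6

/-- The number of labels of Eisenstein vectors in a ball is at least the volume of a slightly
smaller ball divided by the covolume of `ℤ[ω]^n`. -/
theorem ballVolume_le_ncard_labelBall [NeZero q] (hϱ : (ϱ : ℂ) ≠ 0) {R s : ℝ}
    (hR : 2 * R < ‖(ϱ : ℂ)‖) (hs : s + 2 * √n ≤ R) :
    ballVolume n s ≤ (labelBall n σ R).ncard * (√3 / 2) ^ n := by
  have hfin : (labelBall n σ R).Finite := Set.toFinite _
  choose! rep hrep using fun (t : Fin n → ZMod q) (ht : t ∈ labelBall n σ R) => ht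
  have hsub : Metric.closedBall (0 : EuclideanSpace ℂ (Fin n)) s ⊆
      ⋃ t ∈ hfin.toFinset, (fun x => x + -eisensteinVec (rep t)) ⁻¹' eisensteinBox n := by
    intro x hx
    rw [mem_closedBall_zero_iff] at hx
    obtain ⟨u, hu⟩ := exists_sub_mem_eisensteinBox x
    -- Rounding `x` to the grid moves it by at most `2√n`, the gap between `s` and `R`.
    have hnu : ‖eisensteinVec u‖ ≤ R := by
      have h1 := norm_le_of_mem_eisensteinBox hu
      have h2 : eisensteinVec u = x - (x - eisensteinVec u) := by abel
      rw [h2]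
      linarith [norm_sub_le x (x - eisensteinVec u)]
    have ht : (fun i => labelling σ (u i)) ∈ labelBall n σ R := ⟨u, rfl, hnu⟩
    obtain ⟨h3, h4⟩ := hrep _ ht
    have h5 : rep (fun i => labelling σ (u i)) = u :=
      eq_of_labelling_eq_of_norm_le hϱ hR (fun i => congrFun h3 i) h4 hnu
    refine Set.mem_biUnion (hfin.mem_toFinset.mpr ht) ?_
    rw [Set.mem_preimage, h5, ← sub_eq_add_neg]
    exact hu
  have hvol : volume (Metric.closedBall (0 : EuclideanSpace ℂ (Fin n)) s) ≤
      ∑ _t ∈ hfin.toFinset, ENNReal.ofReal ((√3 / 2) ^ n) := by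
    refine (measure_mono hsub).trans ((measure_biUnion_finset_le _ _).trans ?_)
    refine Finset.sum_le_sum fun t _ => ?_
    rw [measure_preimage_add_right, volume_eisensteinBox]
  rw [Finset.sum_const, ← Set.ncard_eq_toFinset_card _ hfin] at hvol
  have := ENNReal.toReal_mono (by simp [ENNReal.mul_eq_top]) hvol
  rwa [nsmul_eq_mul, ENNReal.toReal_mul, ENNReal.toReal_natCast,
    ENNReal.toReal_ofReal (by positivity)] at this

/-- If the code and the labels of the ball of radius `R` cover `𝔽_q^n`, then the Construction-A
lattice has covering radius at most `(R + 2 √n) / |ϱ|`. -/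
theorem exists_mem_constructionA_dist_le (hϱ : (ϱ : ℂ) ≠ 0) {R : ℝ}
    {G : Matrix (Fin n) (Fin k) (ZMod q)}
    (h : ∀ v : Fin n → ZMod q, ∃ c ∈ columnCode G, v - c ∈ labelBall n σ R)
    (x : EuclideanSpace ℂ (Fin n)) :
    ∃ y ∈ constructionA ϱ σ G, dist x y ≤ (R + 2 * √n) / ‖(ϱ : ℂ)‖ := by
  -- Round `ϱx` to `u`, then subtract a short `w` so that `u - w` has a codeword as label. The two
  -- moves cost `2√n` and `R`.
  obtain ⟨u, hu⟩ := exists_sub_mem_eisensteinBox ((ϱ : ℂ) • x)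
  obtain ⟨c, hc, w, hw, hwR⟩ := h fun i => labelling σ (u i)
  refine ⟨(ϱ : ℂ)⁻¹ • eisensteinVec (u - w), mem_constructionA_iff.mpr ⟨u - w, ?_, rfl⟩, ?_⟩
  · convert hc using 1
    funext i
    have := congrFun hw i
    simp only [Pi.sub_apply] at this
    simp [this]
  · have h1 : x - (ϱ : ℂ)⁻¹ • eisensteinVec (u - w) =
        (ϱ : ℂ)⁻¹ • (((ϱ : ℂ) • x - eisensteinVec u) + eisensteinVec w) := by
      rw [eisensteinVec_sub, smul_add, smul_sub, smul_sub, smul_smul, inv_mul_cancel₀ hϱ, one_smul]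
      abel
    rw [dist_eq_norm, h1, norm_smul, norm_inv, inv_mul_eq_div]
    gcongr
    have h2 := norm_le_of_mem_eisensteinBox hu
    linarith [norm_add_le ((ϱ : ℂ) • x - eisensteinVec u) (eisensteinVec w)]

/-- Points of norm above `2‖x‖` are farther from `x` than the origin is, leaving finitely many
candidates. -/
theorem exists_nearest_mem_constructionA (hϱ : (ϱ : ℂ) ≠ 0) (G : Matrix (Fin n) (Fin k) (ZMod q))
    (x : EuclideanSpace ℂ (Fin n)) :
    ∃ y ∈ constructionA ϱ σ G, ∀ z ∈ constructionA ϱ σ G, ‖x - y‖ ≤ ‖x - z‖ := by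
  have h0 : 0 < ‖(ϱ : ℂ)‖ := norm_pos_iff.mpr hϱ
  let A : Set (EuclideanSpace ℂ (Fin n)) := {y | y ∈ constructionA ϱ σ G ∧ ‖y‖ ≤ 2 * ‖x‖}
  have hfin : A.Finite := by
    refine ((finite_setOf_norm_eisensteinVec_le n (‖(ϱ : ℂ)‖ * (2 * ‖x‖))).image
      fun u => (ϱ : ℂ)⁻¹ • eisensteinVec u).subset ?_
    rintro y ⟨hy, hyx⟩
    obtain ⟨u, -, rfl⟩ := mem_constructionA_iff.mp hy
    refine ⟨u, ?_, rfl⟩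
    rwa [norm_smul, norm_inv, inv_mul_le_iff₀ h0] at hyx
  have h0A : (0 : EuclideanSpace ℂ (Fin n)) ∈ A :=
    ⟨(constructionA ϱ σ G).zero_mem, by simp⟩
  obtain ⟨y, hyA, hy⟩ := Set.exists_min_image A (fun y => ‖x - y‖) hfin ⟨0, h0A⟩
  refine ⟨y, hyA.1, fun z hz => ?_⟩
  by_cases hzx : ‖z‖ ≤ 2 * ‖x‖
  · exact hy z ⟨hz, hzx⟩
  · have h1 := hy 0 h0A
    simp only [sub_zero] at h1
    have h2 := norm_sub_norm_le z x
    rw [norm_sub_rev] at h2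
    linarith

/-! ### Voronoi regions and the effective radius. -/

theorem isClosed_voronoiRegion (L : Set (EuclideanSpace ℂ (Fin n))) :
    IsClosed (voronoiRegion L) := by
  have : voronoiRegion L = ⋂ y ∈ L, {x | ‖x‖ ≤ ‖x - y‖} := by
    ext x; simp [voronoiRegion]
  rw [this]
  exact isClosed_biInter fun y _ => isClosed_le (by fun_prop) (by fun_prop)

theorem voronoiRegion_subset_closedBall {L : Set (EuclideanSpace ℂ (Fin n))} {R : ℝ}
    (h : ∀ x, ∃ y ∈ L, dist x y ≤ R) : voronoiRegion L ⊆ Metric.closedBall 0 R := by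
  intro x hx
  obtain ⟨y, hy, hxy⟩ := h x
  rw [mem_closedBall_zero_iff]
  rw [dist_eq_norm] at hxy
  exact (hx y hy).trans hxy

/-- Translates of the Voronoi region cover the space, so its volume is at least the covolume. -/
theorem le_volume_voronoiRegion [NeZero q] (hϱ : (ϱ : ℂ) ≠ 0)
    (G : Matrix (Fin n) (Fin k) (ZMod q)) :
    ENNReal.ofReal ((√3 / 2) ^ n) ≤
      (q : ENNReal) ^ k *
        volume (voronoiRegion (constructionA ϱ σ G : Set (EuclideanSpace ℂ (Fin n)))) := by
  set V := voronoiRegion (constructionA ϱ σ G : Set (EuclideanSpace ℂ (Fin n))) with hV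
  have hVm : MeasurableSet V := (isClosed_voronoiRegion _).measurableSet
  choose lift hlift using labelling_surjective (σ := σ)
  let p : (Fin k → ZMod q) → EuclideanSpace ℂ (Fin n) := fun y =>
    (ϱ : ℂ)⁻¹ • eisensteinVec fun i => lift (G.mulVec y i)
  -- The lattice is the union of the cosets `p y + ℤ[ω]^n`, with repetitions if `G` is rank
  -- deficient. The box is cut according to a nearest lattice point `p y + z`.
  have hcover : eisensteinBox n ⊆ ⋃ y, ⋃ z : Fin n → EisensteinInt,
      (fun x => x + -eisensteinVec z) ⁻¹' ((fun x => x + eisensteinVec z) ⁻¹' eisensteinBox n ∩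
        (fun x => x + -p y) ⁻¹' V) := by
    intro x hx
    obtain ⟨l, hl, hmin⟩ := exists_nearest_mem_constructionA (σ := σ) hϱ G x
    obtain ⟨u, ⟨y, hy⟩, hu⟩ := mem_constructionA_iff.mp hl
    obtain ⟨z, hz⟩ := exists_eq_mul_of_labelling_eq (σ := σ) (u := u)
      (v := fun i => lift (G.mulVec y i)) (fun i => by
        rw [hlift]; exact (congrFun hy i).symm)
    have hlz : l = p y + eisensteinVec z := by
      rw [hu]; exact smul_eisensteinVec_eq hϱ hz
    refine Set.mem_iUnion.mpr ⟨y, Set.mem_iUnion.mpr ⟨z, ?_, ?_⟩⟩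
    · simpa using hx
    · have hxl : x + -eisensteinVec z + -p y = x - l := by rw [hlz]; abel
      simp only [Set.mem_preimage, hxl]
      intro m hm
      have := hmin (l + m) ((constructionA ϱ σ G).add_mem hl hm)
      rwa [← sub_sub] at this
  -- For fixed `y`, moving the piece of index `z` by `-z` puts all pieces in one translate of `V`.
  -- They stay disjoint because they lie in different translates of the box.
  have hbound : ∀ y, ∑' z : Fin n → EisensteinInt,
      volume ((fun x => x + eisensteinVec z) ⁻¹' eisensteinBox n ∩ (fun x => x + -p y) ⁻¹' V)
        ≤ volume V := by
    intro y
    have hdisj : Pairwise (Function.onFun Disjoint fun z : Fin n → EisensteinInt =>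
        (fun x => x + eisensteinVec z) ⁻¹' eisensteinBox n ∩ (fun x => x + -p y) ⁻¹' V) := by
      intro z w hzw
      refine Set.disjoint_left.mpr fun x hx hx' => hzw ?_
      have hneg : ∀ z : Fin n → EisensteinInt,
          x - eisensteinVec (-z) = x + eisensteinVec z := by
        intro z; ext i; simp
      have h1 : x - eisensteinVec (-z) ∈ eisensteinBox n := by rw [hneg]; exact hx.1
      have h2 : x - eisensteinVec (-w) ∈ eisensteinBox n := by rw [hneg]; exact hx'.1
      exact neg_injective (eq_of_sub_mem_eisensteinBox h1 h2)
    refine (tsum_meas_le_meas_iUnion_of_disjoint volume (fun z => ?_) hdisj).trans ?_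
    · exact ((measurable_add_const _) (measurableSet_eisensteinBox n)).inter
        ((measurable_add_const _) hVm)
    · calc _ ≤ volume ((fun x => x + -p y) ⁻¹' V) :=
            measure_mono (Set.iUnion_subset fun z => Set.inter_subset_right)
        _ = volume V := measure_preimage_add_right _ _ _
  calc ENNReal.ofReal ((√3 / 2) ^ n) = volume (eisensteinBox n) := (volume_eisensteinBox n).symm
    _ ≤ ∑ y, ∑' z : Fin n → EisensteinInt, volume ((fun x => x + -eisensteinVec z) ⁻¹'
          ((fun x => x + eisensteinVec z) ⁻¹' eisensteinBox n ∩ (fun x => x + -p y) ⁻¹' V)) := by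
        refine (measure_mono hcover).trans ((measure_iUnion_le _).trans ?_)
        rw [tsum_fintype]
        exact Finset.sum_le_sum fun y _ => measure_iUnion_le _
    _ ≤ ∑ _y : Fin k → ZMod q, volume V := by
        refine Finset.sum_le_sum fun y _ => ?_
        simp_rw [measure_preimage_add_right]
        exact hbound y
    _ = (q : ENNReal) ^ k * volume V := by
        simp [ZMod.card]

theorem exists_mem_constructionA_dist_le_two_mul_sqrt (hϱ : (ϱ : ℂ) ≠ 0)
    (G : Matrix (Fin n) (Fin k) (ZMod q)) (x : EuclideanSpace ℂ (Fin n)) :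
    ∃ y ∈ constructionA ϱ σ G, dist x y ≤ 2 * √n := by
  obtain ⟨u, hu⟩ := exists_sub_mem_eisensteinBox x
  exact ⟨_, eisensteinVec_mem_constructionA hϱ G u, by
    rw [dist_eq_norm]; exact norm_le_of_mem_eisensteinBox hu⟩

theorem rpow_ballVolume_div (hn : 0 < n) {r : ℝ} (hr : 0 ≤ r) :
    (ballVolume n r / ballVolume n 1) ^ (1 / (2 * (n : ℝ))) = r := by
  have h1 : ballVolume n r = r ^ (2 * n) * ballVolume n 1 := by
    conv_lhs => rw [← mul_one r]
    exact ballVolume_mul hn hr zero_le_one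
  rw [h1, mul_div_cancel_right₀ _ (ballVolume_one_pos hn).ne']
  have h2 : (1 / (2 * (n : ℝ))) = (((2 * n : ℕ) : ℝ))⁻¹ := by push_cast; rw [one_div]
  rw [h2, Real.pow_rpow_inv_natCast hr (by omega)]

theorem volume_voronoiRegion_ne_top (hϱ : (ϱ : ℂ) ≠ 0) (G : Matrix (Fin n) (Fin k) (ZMod q)) :
    volume (voronoiRegion (constructionA ϱ σ G : Set (EuclideanSpace ℂ (Fin n)))) ≠ ⊤ :=
  ((measure_mono (voronoiRegion_subset_closedBall
    (exists_mem_constructionA_dist_le_two_mul_sqrt hϱ G))).trans_lt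
      measure_closedBall_lt_top).ne

/-- The Voronoi region lies in the ball about the origin of any radius that covers. -/
theorem effectiveRadius_le_coveringRadius (hn : 0 < n) (hϱ : (ϱ : ℂ) ≠ 0)
    (G : Matrix (Fin n) (Fin k) (ZMod q)) :
    effectiveRadius (constructionA ϱ σ G : Set (EuclideanSpace ℂ (Fin n))) ≤
      coveringRadius (constructionA ϱ σ G : Set (EuclideanSpace ℂ (Fin n))) := by
  refine le_csInf ⟨2 * √n, by positivity,
    exists_mem_constructionA_dist_le_two_mul_sqrt hϱ G⟩ ?_
  rintro r ⟨hr0, hr⟩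
  rw [← rpow_ballVolume_div hn hr0]
  have h1 := ballVolume_one_pos hn
  refine Real.rpow_le_rpow (by positivity) ?_ (by positivity)
  gcongr
  exact ENNReal.toReal_mono measure_closedBall_lt_top.ne
    (measure_mono (voronoiRegion_subset_closedBall hr))

/-- No rank condition on `G` is needed: dependent columns only enlarge the Voronoi region. -/
theorem le_effectiveRadius [NeZero q] (hn : 0 < n) (hϱ : (ϱ : ℂ) ≠ 0)
    (G : Matrix (Fin n) (Fin k) (ZMod q)) {r : ℝ} (hr : 0 < r)
    (hvol : (q : ℝ) ^ k = (√3 / 2) ^ n / ballVolume n r) :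
    r ≤ effectiveRadius (constructionA ϱ σ G : Set (EuclideanSpace ℂ (Fin n))) := by
  have h1 := ballVolume_one_pos hn
  have h2 : 0 < ballVolume n r := by rw [ballVolume_eq hn hr.le]; positivity
  have hq : (0 : ℝ) < q := by exact_mod_cast NeZero.pos q
  conv_lhs => rw [← rpow_ballVolume_div hn hr.le]
  refine Real.rpow_le_rpow (by positivity) ?_ (by positivity)
  gcongr
  have h3 := ENNReal.toReal_mono (by
    refine ENNReal.mul_ne_top ?_ (volume_voronoiRegion_ne_top hϱ G)
    exact ENNReal.pow_ne_top (ENNReal.natCast_ne_top q)) (le_volume_voronoiRegion (σ := σ) hϱ G)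
  rw [ENNReal.toReal_ofReal (by positivity), ENNReal.toReal_mul, ENNReal.toReal_pow,
    ENNReal.toReal_natCast, hvol, div_mul_eq_mul_div, le_div_iff₀ h2] at h3
  exact le_of_mul_le_mul_left h3 (by positivity)

/-- If the balls of radius at most `(1 + δ) r` around the lattice points cover the space, where
`r` is the radius of a ball of the nominal covolume, then the ratio of the covering radius to the
effective radius is within `δ` of `1`. -/
theorem abs_coveringRadius_div_effectiveRadius_sub_one_le [NeZero q] (hn : 0 < n)
    (hϱ : (ϱ : ℂ) ≠ 0) (G : Matrix (Fin n) (Fin k) (ZMod q)) {r δ : ℝ} (hr : 0 < r) (hδ : 0 ≤ δ)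
    (hvol : (q : ℝ) ^ k = (√3 / 2) ^ n / ballVolume n r)
    (hcov : ∀ x : EuclideanSpace ℂ (Fin n), ∃ y ∈ constructionA ϱ σ G, dist x y ≤ (1 + δ) * r) :
    |coveringRadius (constructionA ϱ σ G : Set (EuclideanSpace ℂ (Fin n))) /
      effectiveRadius (constructionA ϱ σ G : Set (EuclideanSpace ℂ (Fin n))) - 1| ≤ δ := by
  have h1 := effectiveRadius_le_coveringRadius (σ := σ) hn hϱ G
  have h2 := le_effectiveRadius (σ := σ) hn hϱ G hr hvol
  have h3 : coveringRadius (constructionA ϱ σ G : Set (EuclideanSpace ℂ (Fin n))) ≤ (1 + δ) * r :=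
    csInf_le ⟨0, fun _ h => h.1⟩ ⟨by positivity, hcov⟩
  set e := effectiveRadius (constructionA ϱ σ G : Set (EuclideanSpace ℂ (Fin n)))
  have he : 0 < e := hr.trans_le h2
  rw [abs_le]
  constructor
  · have := (one_le_div he).mpr h1
    linarith
  · rw [sub_le_iff_le_add, div_le_iff₀ he]
    nlinarith

end ConstructionA

/-! ### Covering a finite vector space by a random linear code. -/

section RandomCode

variable {F V : Type*} [Field F] [Fintype F] [AddCommGroup V] [Module F V] [Fintype V]

open Classical in
/-- The vectors that are not covered by the translates of `S` by the span of the vectors `g i`. -/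
noncomputable def uncovered (F : Type*) {V : Type*} [Field F] [AddCommGroup V] [Module F V]
    [Fintype V] (S : Finset V) {m : ℕ} (g : Fin m → V) : Finset V :=
  {x | ∀ y : Fin m → F, x - ∑ i, y i • g i ∉ S}

omit [Fintype F] in
theorem mem_uncovered {S : Finset V} {m : ℕ} {g : Fin m → V} {x : V} :
    x ∈ uncovered F S g ↔ ∀ y : Fin m → F, x - ∑ i, y i • g i ∉ S := by
  simp [uncovered]

omit [Fintype F] in
/-- A nonzero linear combination of independent uniform vectors is uniform. -/
theorem card_mul_sum_linearCombination {m : ℕ} {w : Fin m → F} (hw : w ≠ 0) (f : V → ℝ) :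
    (Fintype.card V : ℝ) * ∑ g : Fin m → V, f (∑ i, w i • g i) =
      (Fintype.card V : ℝ) ^ m * ∑ v, f v := by
  obtain ⟨i₀, hi₀⟩ := Function.ne_iff.mp hw
  -- Translating the single generator `g i₀` by `(w i₀)⁻¹ v` shifts the combination by `v`;
  -- averaging over `v` then gives uniformity.
  have hshift : ∀ v : V, ∑ g : Fin m → V, f (∑ i, w i • g i) =
      ∑ g : Fin m → V, f (∑ i, w i • g i + v) := by
    intro v
    rw [← Equiv.sum_comp (Equiv.addRight (Pi.single i₀ ((w i₀)⁻¹ • v)))]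
    refine Finset.sum_congr rfl fun g _ => congrArg f ?_
    simp only [Equiv.coe_addRight, Pi.add_apply, smul_add, Finset.sum_add_distrib]
    congr 1
    rw [Finset.sum_eq_single i₀]
    · rw [Pi.single_eq_same, smul_smul, mul_inv_cancel₀ hi₀, one_smul]
    · intro j _ hj
      rw [Pi.single_eq_of_ne hj, smul_zero]
    · simp
  calc (Fintype.card V : ℝ) * ∑ g : Fin m → V, f (∑ i, w i • g i)
      = ∑ v : V, ∑ g : Fin m → V, f (∑ i, w i • g i + v) := by
        rw [← Finset.sum_congr rfl fun v _ => hshift v]; simp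
    _ = ∑ g : Fin m → V, ∑ v : V, f v := by
        rw [Finset.sum_comm]
        exact Finset.sum_congr rfl fun g _ => Equiv.sum_comp (Equiv.addLeft (∑ i, w i • g i)) f
    _ = (Fintype.card V : ℝ) ^ m * ∑ v, f v := by simp

open Classical in
/-- Second-moment bound for the mean number of vectors left uncovered by a random code. -/
theorem sum_card_uncovered_mul_le (S : Finset V) (m : ℕ) :
    (∑ g : Fin m → V, ((uncovered F S g).card : ℝ)) * ((Fintype.card F : ℝ) ^ m * S.card) ≤
      (Fintype.card V : ℝ) ^ m * (Fintype.card V : ℝ) ^ 2 := by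
  set N : ℝ := (Fintype.card V : ℝ) with hN
  set M : ℝ := (Fintype.card F : ℝ) ^ m with hM
  set s : ℝ := (S.card : ℝ) with hs
  have hNpos : 0 < N := by rw [hN]; exact_mod_cast Fintype.card_pos
  have hMpos : 0 < M := by
    have : (0 : ℝ) < Fintype.card F := by exact_mod_cast Fintype.card_pos
    positivity
  rcases S.eq_empty_or_nonempty with rfl | hSne
  · simp only [hs, Finset.card_empty, Nat.cast_zero, mul_zero]; positivity
  have hspos : 0 < s := by rw [hs]; exact_mod_cast hSne.card_pos
  let f : V → ℝ := fun v => if v ∈ S then 1 else 0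
  have hf : ∑ v, f v = s := by simp [f, hs]
  -- `X g x` counts the coefficient vectors that cover `x`. Its average over `x` is `M s / N` for
  -- every `g`.
  let X : (Fin m → V) → V → ℝ := fun g x => ∑ y : Fin m → F, f (x - ∑ i, y i • g i)
  have hsumX : ∀ g, ∑ x, X g x = M * s := by
    intro g
    rw [Finset.sum_comm]
    have : ∀ y : Fin m → F, ∑ x, f (x - ∑ i, y i • g i) = s := fun y => by
      rw [← hf]; exact Equiv.sum_comp (Equiv.subRight (∑ i, y i • g i)) f
    simp [this, hM]
  -- Summing over `x` acts as a uniform random shift, so only `y - y' ≠ 0` is needed for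
  -- independence and `y = 0` is no exception.
  have hpair : ∀ y y' : Fin m → F, ∑ g : Fin m → V, ∑ x, f (x - ∑ i, y i • g i) *
      f (x - ∑ i, y' i • g i) ≤ (if y = y' then N ^ m * s else 0) + N ^ m * s ^ 2 / N := by
    intro y y'
    split_ifs with h
    · subst h
      have h1 : ∀ g : Fin m → V, ∑ x, f (x - ∑ i, y i • g i) * f (x - ∑ i, y i • g i) = s := by
        intro g
        rw [← hf, ← Equiv.sum_comp (Equiv.subRight (∑ i, y i • g i)) f]
        refine Finset.sum_congr rfl fun x _ => ?_
        simp only [Equiv.subRight_apply, f]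
        split_ifs <;> simp
      simp only [h1, Finset.sum_const, Finset.card_univ, Fintype.card_fun, Fintype.card_fin,
        nsmul_eq_mul, Nat.cast_pow, ← hN]
      have : 0 ≤ N ^ m * s ^ 2 / N := by positivity
      linarith
    · have hw : y - y' ≠ 0 := sub_ne_zero.mpr h
      have h1 : ∀ g : Fin m → V, ∑ x, f (x - ∑ i, y i • g i) * f (x - ∑ i, y' i • g i) =
          ∑ x, f x * f (x + ∑ i, (y - y') i • g i) := by
        intro g
        rw [← Equiv.sum_comp (Equiv.addRight (∑ i, y i • g i))
          fun x => f (x - ∑ i, y i • g i) * f (x - ∑ i, y' i • g i)]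
        refine Finset.sum_congr rfl fun x _ => ?_
        simp only [Equiv.coe_addRight, Pi.sub_apply, sub_smul, Finset.sum_sub_distrib]
        congr 2 <;> abel
      simp_rw [h1]
      rw [Finset.sum_comm]
      have h2 : ∀ x, ∑ g : Fin m → V, f x * f (x + ∑ i, (y - y') i • g i) =
          f x * (N ^ m * s / N) := by
        intro x
        rw [← Finset.mul_sum]
        congr 1
        have := card_mul_sum_linearCombination hw fun v => f (x + v)
        have h3 : ∑ v, f (x + v) = s := hf ▸ Equiv.sum_comp (Equiv.addLeft x) f
        rw [h3] at this
        rw [eq_div_iff hNpos.ne', mul_comm]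
        exact this
      rw [Finset.sum_congr rfl fun x _ => h2 x, ← Finset.sum_mul, hf, zero_add]
      apply le_of_eq; ring
  have hsq : ∑ g : Fin m → V, ∑ x, X g x ^ 2 ≤ M * (N ^ m * s) + M ^ 2 * (N ^ m * s ^ 2 / N) := by
    have h1 : ∑ g : Fin m → V, ∑ x, X g x ^ 2 = ∑ y : Fin m → F, ∑ y' : Fin m → F,
        ∑ g : Fin m → V, ∑ x, f (x - ∑ i, y i • g i) * f (x - ∑ i, y' i • g i) := by
      have h2 : ∀ g x, X g x ^ 2 = ∑ y : Fin m → F, ∑ y' : Fin m → F,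
          f (x - ∑ i, y i • g i) * f (x - ∑ i, y' i • g i) := by
        intro g x
        rw [sq, Finset.sum_mul_sum]
      simp_rw [h2]
      calc _ = ∑ g : Fin m → V, ∑ y : Fin m → F, ∑ y' : Fin m → F, ∑ x,
            f (x - ∑ i, y i • g i) * f (x - ∑ i, y' i • g i) := by
            refine Finset.sum_congr rfl fun g _ => ?_
            rw [Finset.sum_comm]
            exact Finset.sum_congr rfl fun y _ => Finset.sum_comm
        _ = _ := by
            rw [Finset.sum_comm]
            exact Finset.sum_congr rfl fun y _ => Finset.sum_comm
    rw [h1]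
    calc _ ≤ ∑ y : Fin m → F, ∑ y' : Fin m → F,
          ((if y = y' then N ^ m * s else 0) + N ^ m * s ^ 2 / N) :=
          Finset.sum_le_sum fun y _ => Finset.sum_le_sum fun y' _ => hpair y y'
      _ = M * (N ^ m * s) + M ^ 2 * (N ^ m * s ^ 2 / N) := by
          simp [Finset.sum_add_distrib, hM]; ring
  have hvar : ∑ g : Fin m → V, ∑ x, (X g x - M * s / N) ^ 2 ≤ M * (N ^ m * s) := by
    have h1 : ∑ g : Fin m → V, ∑ x, (X g x - M * s / N) ^ 2 =
        ∑ g : Fin m → V, ∑ x, X g x ^ 2 - N ^ m * (M * s) ^ 2 / N := by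
      have h2 : ∀ g, ∑ x, (X g x - M * s / N) ^ 2 = ∑ x, X g x ^ 2 - (M * s) ^ 2 / N := by
        intro g
        simp_rw [sub_sq]
        rw [Finset.sum_add_distrib, Finset.sum_sub_distrib, ← Finset.sum_mul, ← Finset.mul_sum,
          hsumX]
        simp only [Finset.sum_const, Finset.card_univ, nsmul_eq_mul, ← hN]
        field_simp
        ring
      simp_rw [h2]
      rw [Finset.sum_sub_distrib]
      simp [← hN]
      ring
    rw [h1]
    have : M ^ 2 * (N ^ m * s ^ 2 / N) = N ^ m * (M * s) ^ 2 / N := by ring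
    linarith
  -- Chebyshev: an uncovered `x` has `X g x = 0`, hence deviates by the full mean.
  have hlow : (∑ g : Fin m → V, ((uncovered F S g).card : ℝ)) * (M * s / N) ^ 2 ≤
      ∑ g : Fin m → V, ∑ x, (X g x - M * s / N) ^ 2 := by
    rw [Finset.sum_mul]
    refine Finset.sum_le_sum fun g _ => ?_
    calc ((uncovered F S g).card : ℝ) * (M * s / N) ^ 2
        = ∑ x ∈ uncovered F S g, (X g x - M * s / N) ^ 2 := by
          rw [← nsmul_eq_mul, ← Finset.sum_const]
          refine Finset.sum_congr rfl fun x hx => ?_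
          have hX : X g x = 0 := Finset.sum_eq_zero fun y _ =>
            if_neg (mem_uncovered.mp hx y)
          rw [hX]; ring
      _ ≤ _ := Finset.sum_le_univ_sum_of_nonneg fun x => sq_nonneg _
  have h := hlow.trans hvar
  have h2 : (∑ g : Fin m → V, ((uncovered F S g).card : ℝ)) * (M * s / N) ^ 2 =
      (∑ g : Fin m → V, ((uncovered F S g).card : ℝ)) * (M * s) * (M * s / N ^ 2) := by ring
  have h3 : M * (N ^ m * s) = N ^ m * N ^ 2 * (M * s / N ^ 2) := by field_simp
  rw [h2, h3] at h
  exact le_of_mul_le_mul_right h (by positivity)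

omit [Fintype F] in
open Classical in
/-- Adding one random generator squares the fraction of uncovered vectors, on average. -/
theorem sum_card_uncovered_cons_le (S : Finset V) {m : ℕ} (g : Fin m → V) :
    ∑ v : V, ((uncovered F S (Fin.cons v g : Fin (m + 1) → V)).card : ℝ) ≤
      ((uncovered F S g).card : ℝ) ^ 2 := by
  set D := uncovered F S g with hD
  -- Coefficients `0` and `1` of the new generator suffice: both `x` and `x - v` must have been
  -- uncovered.
  have h1 : ∀ v : V, uncovered F S (Fin.cons v g : Fin (m + 1) → V) ⊆
      D.filter fun x => x - v ∈ D := by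
    intro v x hx
    have hx' := mem_uncovered.mp hx
    refine Finset.mem_filter.mpr ⟨mem_uncovered.mpr fun y => ?_, mem_uncovered.mpr fun y => ?_⟩
    · have := hx' (Fin.cons 0 y)
      simpa [Fin.sum_univ_succ] using this
    · have := hx' (Fin.cons 1 y)
      simpa [Fin.sum_univ_succ, sub_sub] using this
  calc _ ≤ ∑ v : V, ((D.filter fun x => x - v ∈ D).card : ℝ) :=
        Finset.sum_le_sum fun v _ => by exact_mod_cast Finset.card_le_card (h1 v)
    _ = ∑ x ∈ D, ∑ v : V, if x - v ∈ D then (1 : ℝ) else 0 := by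
        rw [Finset.sum_comm]
        refine Finset.sum_congr rfl fun v _ => ?_
        rw [Finset.card_filter]; push_cast; rfl
    _ = ∑ x ∈ D, (D.card : ℝ) := by
        refine Finset.sum_congr rfl fun x _ => ?_
        have := Equiv.sum_comp (Equiv.subLeft x) fun v => if v ∈ D then (1 : ℝ) else 0
        simp only [Equiv.subLeft_apply] at this
        rw [this]; simp
    _ = _ := by rw [Finset.sum_const, nsmul_eq_mul, sq]

open Classical in
/-- The fraction of generator tuples that leave more than `a` vectors uncovered. -/
noncomputable def uncoveredTail (F : Type*) {V : Type*} [Field F] [AddCommGroup V] [Module F V]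
    [Fintype V] (S : Finset V) (m : ℕ) (a : ℝ) : ℝ :=
  (∑ g : Fin m → V, if a < ((uncovered F S g).card : ℝ) then (1 : ℝ) else 0) /
    (Fintype.card V : ℝ) ^ m

/-- Markov's inequality applied to the second-moment bound. -/
theorem uncoveredTail_le (S : Finset V) (hS : S.Nonempty) (m : ℕ) {a : ℝ} (ha : 0 < a) :
    uncoveredTail F S m a ≤
      (Fintype.card V : ℝ) ^ 2 / ((Fintype.card F : ℝ) ^ m * S.card * a) := by
  have hN : (0 : ℝ) < Fintype.card V := by exact_mod_cast Fintype.card_pos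
  have hq : (0 : ℝ) < Fintype.card F := by exact_mod_cast Fintype.card_pos
  have hs : (0 : ℝ) < S.card := by exact_mod_cast hS.card_pos
  have h := sum_card_uncovered_mul_le (F := F) S m
  have h2 : (∑ g : Fin m → V, if a < ((uncovered F S g).card : ℝ) then (1 : ℝ) else 0) * a ≤
      ∑ g : Fin m → V, ((uncovered F S g).card : ℝ) := by
    rw [Finset.sum_mul]
    refine Finset.sum_le_sum fun g _ => ?_
    split_ifs with h
    · linarith
    · simp
  rw [uncoveredTail, div_le_div_iff₀ (by positivity) (by positivity)]
  calc _ = (∑ g : Fin m → V, if a < ((uncovered F S g).card : ℝ) then (1 : ℝ) else 0) * a *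
        ((Fintype.card F : ℝ) ^ m * S.card) := by ring
    _ ≤ _ := mul_le_mul_of_nonneg_right h2 (by positivity)
    _ ≤ _ := h
    _ = _ := by ring

omit [Fintype F] in
-- Either the old generators already leave more than `a` vectors uncovered, or the new mean is at
-- most `a² / |V|` and Markov's inequality applies.
theorem uncoveredTail_succ_le (S : Finset V) (m : ℕ) {a b : ℝ} (hb : 0 < b) :
    uncoveredTail F S (m + 1) b ≤
      uncoveredTail F S m a + a ^ 2 / (b * Fintype.card V) := by
  classical
  have hN : (0 : ℝ) < Fintype.card V := by exact_mod_cast Fintype.card_pos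
  set N : ℝ := (Fintype.card V : ℝ) with hNdef
  have hcons : (∑ g : Fin (m + 1) → V, if b < ((uncovered F S g).card : ℝ) then (1 : ℝ) else 0) =
      ∑ g : Fin m → V, ∑ v : V,
        if b < ((uncovered F S (Fin.cons v g : Fin (m + 1) → V)).card : ℝ) then (1 : ℝ) else 0 := by
    rw [← (Fin.consEquiv fun _ : Fin (m + 1) => V).sum_comp, Fintype.sum_prod_type_right]
    rfl
  have hstep : ∀ g : Fin m → V, (∑ v : V,
      if b < ((uncovered F S (Fin.cons v g : Fin (m + 1) → V)).card : ℝ) then (1 : ℝ) else 0) ≤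
      N * (if a < ((uncovered F S g).card : ℝ) then (1 : ℝ) else 0) + a ^ 2 / b := by
    intro g
    split_ifs with h
    · have h1 : (∑ v : V, if b < ((uncovered F S (Fin.cons v g : Fin (m + 1) → V)).card : ℝ)
          then (1 : ℝ) else 0) ≤ ∑ _v : V, (1 : ℝ) :=
        Finset.sum_le_sum fun v _ => by split_ifs <;> norm_num
      simp only [Finset.sum_const, Finset.card_univ, nsmul_eq_mul, ← hNdef] at h1
      have : 0 ≤ a ^ 2 / b := by positivity
      linarith
    · rw [mul_zero, zero_add, le_div_iff₀ hb, Finset.sum_mul]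
      calc _ ≤ ∑ v : V, ((uncovered F S (Fin.cons v g : Fin (m + 1) → V)).card : ℝ) := by
            refine Finset.sum_le_sum fun v _ => ?_
            split_ifs with h
            · linarith
            · simp
        _ ≤ ((uncovered F S g).card : ℝ) ^ 2 := sum_card_uncovered_cons_le S g
        _ ≤ a ^ 2 := by
            have := not_lt.mp h
            gcongr
  rw [uncoveredTail, hcons, div_le_iff₀ (by positivity)]
  calc _ ≤ ∑ g : Fin m → V,
        (N * (if a < ((uncovered F S g).card : ℝ) then (1 : ℝ) else 0) + a ^ 2 / b) :=
        Finset.sum_le_sum fun g _ => hstep g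
    _ = (uncoveredTail F S m a + a ^ 2 / (b * N)) * N ^ (m + 1) := by
        rw [Finset.sum_add_distrib, ← Finset.mul_sum, uncoveredTail]
        simp only [Finset.sum_const, Finset.card_univ, Fintype.card_fun, Fintype.card_fin,
          nsmul_eq_mul, Nat.cast_pow, ← hNdef]
        field_simp
        ring

omit [Fintype F] in
-- The thresholds are squared as fractions at each step, up to the factor `L`, so that every Markov
-- step costs exactly `1 / L`.
theorem uncoveredTail_add_le (S : Finset V) (m t : ℕ) {c L : ℝ} (hc : 0 < c) (hL : 0 < L) :
    uncoveredTail F S (m + t) (Fintype.card V * c ^ 2 ^ t / L) ≤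
      uncoveredTail F S m (Fintype.card V * c / L) + t / L := by
  have hN : (0 : ℝ) < Fintype.card V := by exact_mod_cast Fintype.card_pos
  induction t with
  | zero => simp
  | succ t ih =>
    have h := uncoveredTail_succ_le (F := F) S (m + t) (a := Fintype.card V * c ^ 2 ^ t / L)
      (b := Fintype.card V * c ^ 2 ^ (t + 1) / L) (by positivity)
    have h2 : ((Fintype.card V : ℝ) * c ^ 2 ^ t / L) ^ 2 /
        (Fintype.card V * c ^ 2 ^ (t + 1) / L * Fintype.card V) = 1 / L := by
      have : c ^ 2 ^ (t + 1) = (c ^ 2 ^ t) ^ 2 := by rw [← pow_mul, pow_succ]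
      rw [this]
      field_simp
    rw [h2] at h
    rw [← add_assoc]
    push_cast
    calc _ ≤ _ := h
      _ ≤ uncoveredTail F S m (Fintype.card V * c / L) + t / L + 1 / L := by gcongr
      _ = _ := by ring

/-- With high probability a random code together with `S` covers the whole space. -/
theorem uncoveredTail_zero_le (S : Finset V) (hS : S.Nonempty) (m t : ℕ) {L : ℝ}
    (hL : 0 < L) (ht : (Fintype.card V : ℝ) < L * 2 ^ 2 ^ t) :
    uncoveredTail F S (m + t) 0 ≤
      2 * L * Fintype.card V / ((Fintype.card F : ℝ) ^ m * S.card) + t / L := by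
  have hN : (0 : ℝ) < Fintype.card V := by exact_mod_cast Fintype.card_pos
  have hq : (0 : ℝ) < Fintype.card F := by exact_mod_cast Fintype.card_pos
  have hs : (0 : ℝ) < S.card := by exact_mod_cast hS.card_pos
  have h1 := uncoveredTail_add_le (F := F) S m t (c := 1 / 2) (L := L) (by norm_num) hL
  have h2 := uncoveredTail_le (F := F) S hS m (a := Fintype.card V * (1 / 2) / L) (by positivity)
  -- A threshold below `1` amounts to threshold `0`, the number of uncovered vectors being an
  -- integer.
  have h3 : (Fintype.card V : ℝ) * (1 / 2) ^ 2 ^ t / L < 1 := by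
    rw [div_lt_one hL, one_div, inv_pow, ← div_eq_mul_inv, div_lt_iff₀ (by positivity)]
    exact ht
  have h4 : uncoveredTail F S (m + t) 0 ≤
      uncoveredTail F S (m + t) (Fintype.card V * (1 / 2) ^ 2 ^ t / L) := by
    unfold uncoveredTail
    gcongr with g _
    split_ifs with h5 h6
    · exact le_rfl
    · exfalso
      apply h6
      have : (1 : ℝ) ≤ (uncovered F S g).card := by exact_mod_cast h5
      linarith
    · norm_num
    · norm_num
  have h5 : (Fintype.card V : ℝ) ^ 2 /
      ((Fintype.card F : ℝ) ^ m * S.card * (Fintype.card V * (1 / 2) / L)) =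
      2 * L * Fintype.card V / ((Fintype.card F : ℝ) ^ m * S.card) := by field_simp
  linarith

end RandomCode

/-! ### The deviation bound at finite length. -/

theorem generatorLaw_singleton {n k q : ℕ} [NeZero q] (G : Fin n → Fin k → ZMod q) :
    generatorLaw n k q {G} = ENNReal.ofReal (1 / ((q : ℝ) ^ n) ^ k) := by
  have hq : (0 : ℝ) < q := by exact_mod_cast NeZero.pos q
  have hp : IsProbabilityMeasure (ProbabilityTheory.uniformOn (Set.univ : Set (ZMod q))) :=
    ProbabilityTheory.isProbabilityMeasure_uniformOn Set.finite_univ Set.univ_nonempty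
  have h1 : ∀ x : ZMod q, ProbabilityTheory.uniformOn Set.univ {x} = ENNReal.ofReal (1 / q) := by
    intro x
    rw [ProbabilityTheory.uniformOn_univ, Measure.count_singleton, ZMod.card, one_div, one_div,
      ENNReal.ofReal_inv_of_pos hq, ENNReal.ofReal_natCast]
  rw [generatorLaw, Measure.pi_singleton]
  simp_rw [Measure.pi_singleton, h1]
  simp only [Finset.prod_const, Finset.card_univ, Fintype.card_fin]
  rw [← pow_mul, ← ENNReal.ofReal_pow (by positivity), one_div_pow, ← pow_mul, mul_comm]

theorem generatorLaw_le_uncoveredTail {n k q : ℕ} [Fact q.Prime] (S : Finset (Fin n → ZMod q))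
    (A : Set (Fin n → Fin k → ZMod q))
    (hA : ∀ G ∈ A, (uncovered (ZMod q) S fun j i => G i j).Nonempty) :
    generatorLaw n k q A ≤ ENNReal.ofReal (uncoveredTail (ZMod q) S k 0) := by
  classical
  have hAf : A.Finite := Set.toFinite A
  have h1 : generatorLaw n k q A = ∑ G ∈ hAf.toFinset, generatorLaw n k q {G} := by
    rw [sum_measure_singleton, hAf.coe_toFinset]
  rw [h1]
  simp_rw [generatorLaw_singleton]
  rw [← ENNReal.ofReal_sum_of_nonneg fun _ _ => by positivity]
  refine ENNReal.ofReal_le_ofReal ?_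
  -- The generators are the columns of `G`, hence the exchange of the two indices.
  rw [uncoveredTail, Finset.sum_div, ← Equiv.sum_comp (Equiv.piComm fun _ _ => ZMod q)]
  calc _ ≤ ∑ G ∈ hAf.toFinset, (if (0 : ℝ) < (uncovered (ZMod q) S fun j i => G i j).card
        then (1 : ℝ) else 0) / (Fintype.card (Fin n → ZMod q) : ℝ) ^ k := by
        refine Finset.sum_le_sum fun G hG => ?_
        have h2 := (hA G (hAf.mem_toFinset.mp hG)).card_pos
        rw [if_pos (by exact_mod_cast h2)]
        simp [ZMod.card]
    _ ≤ _ := Finset.sum_le_univ_sum_of_nonneg fun G => by split_ifs <;> positivity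

/-- A finite-length bound on the probability that the ratio of the covering radius to the effective
radius of a random Construction-A lattice deviates from `1`. -/
theorem generatorLaw_deviation_le {n m t q : ℕ} [Fact q.Prime] (hn : 0 < n) {ϱ : EisensteinInt}
    (σ : (EisensteinInt ⧸ Ideal.span {ϱ}) ≃+* ZMod q) (hϱ : ‖(ϱ : ℂ)‖ ^ 2 = q) {r η : ℝ}
    (hr : 0 < r) (hη : 0 < η) (hvol : (q : ℝ) ^ (m + t) = (√3 / 2) ^ n / ballVolume n r)
    (hsmall : (1 + 2 * η) * r < 1 / 2) (hgrid : 4 * √n ≤ η * r * √q)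
    (ht : (q : ℝ) ^ n < n * 2 ^ 2 ^ t) :
    generatorLaw n (m + t) q
        {G | 2 * η < |coveringRadius (constructionA ϱ σ (Matrix.of G) :
              Set (EuclideanSpace ℂ (Fin n))) /
            effectiveRadius (constructionA ϱ σ (Matrix.of G) :
              Set (EuclideanSpace ℂ (Fin n))) - 1|} ≤
      ENNReal.ofReal (2 * n * (q : ℝ) ^ t / (1 + η) ^ (2 * n) + t / n) := by
  have hq : (0 : ℝ) < q := by exact_mod_cast (Fact.out : q.Prime).pos
  have hnorm : ‖(ϱ : ℂ)‖ = √q := by rw [← hϱ, Real.sqrt_sq (norm_nonneg _)]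
  have hsq : 0 < √(q : ℝ) := Real.sqrt_pos.mpr hq
  have hϱ0 : (ϱ : ℂ) ≠ 0 := by rw [← norm_pos_iff, hnorm]; exact hsq
  -- One `η r` of the slack enlarges the ball; the other absorbs both rounding errors `2√n / √q`
  -- through `hgrid`.
  set R : ℝ := √q * ((1 + η) * r) + 2 * √n with hR
  have hcard : (q : ℝ) ^ n * (1 + η) ^ (2 * n) ≤ (q : ℝ) ^ (m + t) * (labelBall n σ R).ncard := by
    have h1 := ballVolume_le_ncard_labelBall (n := n) (σ := σ) hϱ0 (R := R)
      (s := √q * ((1 + η) * r)) (by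
        have h2 := mul_lt_mul_of_pos_left hsmall hsq
        have h3 : 0 < √q * (η * r) := by positivity
        rw [hnorm, hR]
        linarith) le_rfl
    rw [ballVolume_mul hn hsq.le (by positivity), ballVolume_mul hn (by positivity) hr.le,
      pow_mul, Real.sq_sqrt hq.le] at h1
    have h2 : 0 < ballVolume n r := by rw [ballVolume_eq hn hr.le]; positivity
    rw [hvol, div_mul_eq_mul_div, le_div_iff₀ h2]
    linarith
  have hcov : ∀ G : Fin n → Fin (m + t) → ZMod q, 2 * η <
      |coveringRadius (constructionA ϱ σ (Matrix.of G) : Set (EuclideanSpace ℂ (Fin n))) /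
        effectiveRadius (constructionA ϱ σ (Matrix.of G) :
          Set (EuclideanSpace ℂ (Fin n))) - 1| →
      (uncovered (ZMod q) (Set.toFinite (labelBall n σ R)).toFinset fun j i => G i j).Nonempty := by
    intro G hG
    by_contra hne
    refine absurd hG (not_lt.mpr ?_)
    refine abs_coveringRadius_div_effectiveRadius_sub_one_le hn hϱ0 _ hr (by positivity) hvol ?_
    intro x
    obtain ⟨y, hy, hxy⟩ := exists_mem_constructionA_dist_le (σ := σ) hϱ0 (R := R)
      (G := Matrix.of G) (fun v => by
        have hv : v ∉ uncovered (ZMod q) (Set.toFinite (labelBall n σ R)).toFinset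
            fun j i => G i j := fun hv => hne ⟨v, hv⟩
        rw [mem_uncovered] at hv
        push Not at hv
        obtain ⟨y, hy⟩ := hv
        refine ⟨_, ⟨y, rfl⟩, ?_⟩
        convert (Set.Finite.mem_toFinset _).mp hy using 2
        funext i
        simp [Matrix.mulVec, dotProduct, mul_comm]) x
    refine ⟨y, hy, hxy.trans ?_⟩
    rw [hnorm, div_le_iff₀ hsq, hR]
    nlinarith
  have hne : (labelBall n σ R).Nonempty :=
    ⟨_, 0, rfl, by
      have : eisensteinVec (0 : Fin n → EisensteinInt) = 0 := by ext i; simp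
      rw [this, norm_zero]; positivity⟩
  have hpos : (0 : ℝ) < (labelBall n σ R).ncard := by
    exact_mod_cast (Set.ncard_pos (Set.toFinite _)).mpr hne
  refine (generatorLaw_le_uncoveredTail _ _ hcov).trans (ENNReal.ofReal_le_ofReal ?_)
  have hn' : (0 : ℝ) < n := by exact_mod_cast hn
  -- Here `L = n`, so the `t` squaring steps fail with total probability at most `t / n`.
  refine (uncoveredTail_zero_le _ ((Set.Finite.toFinset_nonempty _).mpr hne) m t hn' ?_).trans ?_
  · simpa [ZMod.card] using ht
  · gcongr ?_ + _
    rw [← Set.ncard_eq_toFinset_card]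
    simp only [Fintype.card_fun, Fintype.card_fin, ZMod.card, Nat.cast_pow]
    rw [div_le_div_iff₀ (by positivity) (by positivity)]
    calc 2 * (n : ℝ) * (q : ℝ) ^ n * (1 + η) ^ (2 * n)
        = 2 * n * ((q : ℝ) ^ n * (1 + η) ^ (2 * n)) := by ring
      _ ≤ 2 * n * ((q : ℝ) ^ (m + t) * (labelBall n σ R).ncard) := by gcongr
      _ = _ := by rw [pow_add]; ring

/-! ### Growth of the parameters. -/

theorem nominal_card_eq {n k q : ℕ} (hn : 0 < n) {r : ℝ} (hr : 0 < r)
    (hvol : (q : ℝ) ^ k = (√3 / 2) ^ n / ballVolume n r) :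
    (q : ℝ) ^ k = n.factorial * (√3 / 2 / (r ^ 2 * Real.pi)) ^ n := by
  rw [hvol, ballVolume_eq hn hr.le, div_pow (√3 / 2) (r ^ 2 * Real.pi), mul_pow, pow_mul]
  field_simp

/-- The nominal covolume relation gives `k log q ≤ 2 n log n` for large `n`. -/
theorem natCast_mul_log_le {n k q : ℕ} (hn : 0 < n) (hq : 1 < q) {r r₀ : ℝ} (hr₀ : 0 < r₀)
    (hr : r₀ < r) (hvol : (q : ℝ) ^ k = (√3 / 2) ^ n / ballVolume n r)
    (hlog : √3 / 2 / (r₀ ^ 2 * Real.pi) ≤ n) :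
    (k : ℝ) * Real.log q ≤ 2 * n * Real.log n := by
  have hn' : (0 : ℝ) < n := by exact_mod_cast hn
  have hq' : (0 : ℝ) < q := by positivity
  have hr' : 0 < r := hr₀.trans hr
  have hπ := Real.pi_pos
  have h1 := nominal_card_eq hn hr' hvol
  have h2 : (q : ℝ) ^ k ≤ (n : ℝ) ^ n * (n : ℝ) ^ n := by
    rw [h1]
    gcongr
    · exact_mod_cast Nat.factorial_le_pow n
    · refine le_trans ?_ hlog
      gcongr
  have h3 := Real.log_le_log (by positivity) h2
  rw [Real.log_mul (by positivity) (by positivity), Real.log_pow, Real.log_pow] at h3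
  linarith

/-- The nominal covolume relation gives `n (log n - 1) ≤ k log q`. -/
theorem mul_log_sub_one_le {n k q : ℕ} (hn : 0 < n) (hq : 1 < q) {r : ℝ} (hr : 0 < r)
    (hr' : r < 1 / 2) (hvol : (q : ℝ) ^ k = (√3 / 2) ^ n / ballVolume n r) :
    (n : ℝ) * (Real.log n - 1) ≤ k * Real.log q := by
  have hn' : (0 : ℝ) < n := by exact_mod_cast hn
  have hq' : (0 : ℝ) < q := by positivity
  have hπ := Real.pi_pos
  have h1 := nominal_card_eq hn hr hvol
  -- A disc of radius `1/2` has area `π/4`, less than the covolume `√3/2` of `ℤ[ω]`.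
  have h2 : 1 ≤ √3 / 2 / (r ^ 2 * Real.pi) := by
    rw [one_le_div (by positivity)]
    have h3 : r ^ 2 ≤ 1 / 4 := by nlinarith
    have h4 : (1.7 : ℝ) ≤ √3 := Real.le_sqrt_of_sq_le (by norm_num)
    have h5 := Real.pi_lt_d2
    nlinarith
  have h3 : (n.factorial : ℝ) ≤ (q : ℝ) ^ k := by
    rw [h1]
    exact le_mul_of_one_le_right (by positivity) (one_le_pow₀ h2)
  have h4 := Real.pow_div_factorial_le_exp (n : ℝ) hn'.le n
  rw [div_le_iff₀ (by positivity)] at h4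
  have h5 : (n : ℝ) ^ n ≤ Real.exp n * (q : ℝ) ^ k := h4.trans (by gcongr)
  have h6 := Real.log_le_log (by positivity) h5
  rw [Real.log_mul (by positivity) (by positivity), Real.log_pow, Real.log_pow,
    Real.log_exp] at h6
  linarith

/-- The constant `7` exceeds `4 / log 2 + 1`, where the `1` pays for rounding up since `log n ≥ 1`.
-/
theorem natCast_clog_le {n : ℕ} (hn : 2 ≤ n) (hlog : 1 ≤ Real.log n) :
    (Nat.clog 2 (n ^ 4) : ℝ) ≤ 7 * Real.log n := by
  have h1 : 2 ^ (Nat.clog 2 (n ^ 4)).pred < n ^ 4 :=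
    Nat.pow_pred_clog_lt_self one_lt_two (one_lt_pow₀ (by omega) (by norm_num))
  have h2 : (2 : ℝ) ^ (Nat.clog 2 (n ^ 4)).pred ≤ (n : ℝ) ^ 4 := by exact_mod_cast h1.le
  have h3 := Real.log_le_log (by positivity) h2
  rw [Real.log_pow, Real.log_pow] at h3
  have h4 : (Nat.clog 2 (n ^ 4) : ℝ) ≤ (Nat.clog 2 (n ^ 4)).pred + 1 := by
    have : Nat.clog 2 (n ^ 4) ≤ (Nat.clog 2 (n ^ 4)).pred + 1 := by
      rw [Nat.pred_eq_sub_one]; omega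
    exact_mod_cast this
  have h5 := Real.log_two_gt_d9
  push_cast at h3
  nlinarith [(Nat.cast_nonneg (Nat.clog 2 (n ^ 4)).pred : (0 : ℝ) ≤ _)]

/-- The exponent `4` is a generous choice: `n log q ≤ 2n³` already lies below `n⁴ log 2`. -/
theorem pow_lt_mul_two_pow_two_pow_clog {n k q : ℕ} (hn : 3 ≤ n) (hk : 1 ≤ k) (hq : 1 < q)
    (h : (k : ℝ) * Real.log q ≤ 2 * n * Real.log n) :
    (q : ℝ) ^ n < n * 2 ^ 2 ^ Nat.clog 2 (n ^ 4) := by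
  have hn' : (3 : ℝ) ≤ n := by exact_mod_cast hn
  have hk' : (1 : ℝ) ≤ k := by exact_mod_cast hk
  have hq' : (1 : ℝ) < q := by exact_mod_cast hq
  have hlq : 0 < Real.log q := Real.log_pos hq'
  have hln : 0 < Real.log n := Real.log_pos (by linarith)
  have h1 : (n : ℝ) ^ 4 ≤ 2 ^ Nat.clog 2 (n ^ 4) := by
    exact_mod_cast Nat.le_pow_clog one_lt_two (n ^ 4)
  have h2 : Real.log q ≤ 2 * n * Real.log n := by nlinarith
  have h3 : Real.log n ≤ n := by linarith [Real.log_le_sub_one_of_pos (by linarith : (0 : ℝ) < n)]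
  have h4 := Real.log_two_gt_d9
  rw [← Real.log_lt_log_iff (by positivity) (by positivity), Real.log_mul (by positivity)
    (by positivity), Real.log_pow, Real.log_pow]
  push_cast
  have h5 : (n : ℝ) * Real.log q ≤ 2 * n ^ 3 := by
    calc (n : ℝ) * Real.log q ≤ n * (2 * n * n) := by
          gcongr; exact h2.trans (by gcongr)
      _ = 2 * n ^ 3 := by ring
  have h6 : 2 * (n : ℝ) ^ 3 ≤ n ^ 4 * Real.log 2 := by
    have h7 : (0 : ℝ) ≤ n ^ 3 := by positivity
    have h8 : 2 ≤ n * Real.log 2 := by nlinarith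
    calc 2 * (n : ℝ) ^ 3 ≤ n * Real.log 2 * n ^ 3 := by gcongr
      _ = _ := by ring
  have h7 : (n : ℝ) ^ 4 * Real.log 2 ≤ 2 ^ Nat.clog 2 (n ^ 4) * Real.log 2 := by gcongr
  linarith

/-- When `β < 1`, `log q ≥ (log n - 1) / β` eventually exceeds `log n` by any given constant, so
rounding is negligible at scale `√q`. -/
theorem four_mul_sqrt_le {n q : ℕ} (hn : 0 < n) (hq : 1 < q) {β a : ℝ} (hβ0 : 0 < β)
    (ha : 0 < a) (h1 : Real.log n - 1 ≤ β * Real.log q)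
    (h2 : 1 + β * Real.log (16 / a ^ 2) ≤ (1 - β) * Real.log n) : 4 * √n ≤ a * √q := by
  have hn' : (0 : ℝ) < n := by exact_mod_cast hn
  have hq' : (0 : ℝ) < q := by positivity
  have h3 : Real.log (16 / a ^ 2 * n) ≤ Real.log q := by
    rw [Real.log_mul (by positivity) (by positivity)]
    refine le_of_mul_le_mul_left ?_ hβ0
    linarith
  rw [Real.log_le_log_iff (by positivity) hq', div_mul_eq_mul_div,
    div_le_iff₀ (by positivity)] at h3
  rw [← sq_le_sq₀ (by positivity) (by positivity), mul_pow, mul_pow, Real.sq_sqrt hn'.le,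
    Real.sq_sqrt hq'.le]
  linarith

/-- This is the price of the reserved columns: `k t log q ≤ 14 n log² n`, which is where `log² n =
o(k)` is decisive. -/
theorem pow_clog_le {n k q t : ℕ} {η : ℝ} (hη : 0 < η) (hk : 0 < k)
    (hkq : (k : ℝ) * Real.log q ≤ 2 * n * Real.log n) (hq : 1 < q)
    (ht : (t : ℝ) ≤ 7 * Real.log n) (hn : 1 < n)
    (hlog : Real.log n ^ 2 ≤ Real.log (1 + η) / 14 * k) :
    (q : ℝ) ^ t ≤ (1 + η) ^ n := by
  have hn' : (1 : ℝ) < n := by exact_mod_cast hn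
  have hk' : (0 : ℝ) < k := by exact_mod_cast hk
  have hq' : (1 : ℝ) < q := by exact_mod_cast hq
  have hlq : 0 < Real.log q := Real.log_pos hq'
  have hln : 0 < Real.log n := Real.log_pos hn'
  rw [← Real.log_le_log_iff (by positivity) (by positivity), Real.log_pow, Real.log_pow]
  refine le_of_mul_le_mul_left ?_ hk'
  calc (k : ℝ) * (t * Real.log q) = t * (k * Real.log q) := by ring
    _ ≤ 7 * Real.log n * (2 * n * Real.log n) := by gcongr
    _ = 14 * n * Real.log n ^ 2 := by ring
    _ ≤ 14 * n * (Real.log (1 + η) / 14 * k) := by gcongr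
    _ = _ := by ring

theorem tendsto_deviation_bound {η : ℝ} (hη : 0 < η) :
    Tendsto (fun n : ℕ => 2 * ((n : ℝ) * ((1 + η)⁻¹) ^ n) + 7 * (Real.log n / n))
      atTop (𝓝 0) := by
  have h1 : Tendsto (fun n : ℕ => (n : ℝ) * ((1 + η)⁻¹) ^ n) atTop (𝓝 0) :=
    tendsto_self_mul_const_pow_of_lt_one (by positivity) (inv_lt_one_of_one_lt₀ (by linarith))
  have h2 : Tendsto (fun n : ℕ => Real.log n / n) atTop (𝓝 0) :=
    Real.isLittleO_log_id_atTop.tendsto_div_nhds_zero.comp tendsto_natCast_atTop_atTop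
  simpa using (h1.const_mul 2).add (h2.const_mul 7)

/-! ### The limit. -/

theorem mainTheorem3
    (k q : ℕ → ℕ) (ϱ : ℕ → EisensteinInt)
    (σ : ∀ n, (EisensteinInt ⧸ Ideal.span {ϱ n}) ≃+* ZMod (q n))
    (hq : ∀ n, (q n).Prime) (hq3 : ∀ n, q n ≡ 1 [MOD 3])
    (hϱ : ∀ n, ‖(ϱ n : ℂ)‖ ^ 2 = q n)
    (β : ℝ) (hβ : β < 1) (hkβ : ∀ᶠ n : ℕ in atTop, (k n : ℝ) ≤ β * n)
    (hk : (fun n : ℕ => Real.log n ^ 2) =o[atTop] fun n : ℕ => (k n : ℝ))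
    (r_min : ℝ) (hr0 : 0 < r_min) (hr1 : r_min < 1 / 4)
    (r : ℕ → ℝ)
    (hvol : ∀ᶠ n : ℕ in atTop,
      (q n : ℝ) ^ k n = (Real.sqrt 3 / 2) ^ n / ballVolume n (r n))
    (hr : ∀ᶠ n : ℕ in atTop, r_min < r n ∧ r n < 2 * r_min) :
    ∀ ε : ℝ, 0 < ε →
      Tendsto (fun n : ℕ => generatorLaw n (k n) (q n)
        {G | ε ≤ |coveringRadius (constructionA (ϱ n) (σ n) (Matrix.of G) :
              Set (EuclideanSpace ℂ (Fin n))) /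
            effectiveRadius (constructionA (ϱ n) (σ n) (Matrix.of G) :
              Set (EuclideanSpace ℂ (Fin n))) - 1|})
        atTop (𝓝 0) := by
  intro ε hε
  -- The bound `r_min < 1/4` leaves room for `(1 + 2η) r_n < 1/2`, needed for injective labels.
  obtain ⟨η, hη, hηε, hηr⟩ : ∃ η : ℝ, 0 < η ∧ 2 * η < ε ∧ (1 + 2 * η) * (2 * r_min) < 1 / 2 := by
    refine ⟨min (ε / 4) ((1 / 4 - r_min) / 2), by
      apply lt_min <;> linarith, ?_, ?_⟩
    · linarith [min_le_left (ε / 4) ((1 / 4 - r_min) / 2)]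
    · have := min_le_right (ε / 4) ((1 / 4 - r_min) / 2)
      nlinarith
  have hbound : Tendsto (fun n : ℕ => ENNReal.ofReal
      (2 * ((n : ℝ) * ((1 + η)⁻¹) ^ n) + 7 * (Real.log n / n))) atTop (𝓝 0) := by
    simpa using ENNReal.tendsto_ofReal (tendsto_deviation_bound hη)
  refine tendsto_of_tendsto_of_tendsto_of_le_of_le' tendsto_const_nhds hbound
    (Eventually.of_forall fun _ => zero_le) ?_
  have hlog : Tendsto (fun n : ℕ => Real.log n) atTop atTop :=
    Real.tendsto_log_atTop.comp tendsto_natCast_atTop_atTop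
  have hη1 : 0 < Real.log (1 + η) := Real.log_pos (by linarith)
  -- The constant `1/7` ensures `t ≤ k`, and `log(1 + η)/14` ensures `q^t ≤ (1 + η)^n`.
  have hk1 : ∀ᶠ n : ℕ in atTop, Real.log n ^ 2 ≤ min (1 / 7) (Real.log (1 + η) / 14) * k n := by
    filter_upwards [hk.bound (show 0 < min (1 / 7 : ℝ) (Real.log (1 + η) / 14) by positivity)]
      with n hn
    simpa using hn
  filter_upwards [hkβ, hk1, hvol, hr, hlog.eventually_ge_atTop 1,
    hlog.eventually_ge_atTop ((1 + β * Real.log (16 / (η * r_min) ^ 2)) / (1 - β)),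
    tendsto_natCast_atTop_atTop.eventually_ge_atTop (√3 / 2 / (r_min ^ 2 * Real.pi)),
    eventually_ge_atTop 3] with n hkn hlk hv hrn hln1 hlnβ hnC hn
  have : Fact (q n).Prime := ⟨hq n⟩
  have hq1 : 1 < q n := (hq n).one_lt
  have hn0 : (0 : ℝ) < n := by positivity
  have hrpos : 0 < r n := hr0.trans hrn.1
  have hlk7 : Real.log n ^ 2 ≤ 1 / 7 * k n :=
    hlk.trans (by gcongr; exact min_le_left _ _)
  have hlkη : Real.log n ^ 2 ≤ Real.log (1 + η) / 14 * k n :=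
    hlk.trans (by gcongr; exact min_le_right _ _)
  have hkpos : 1 ≤ k n := by
    have : (0 : ℝ) < k n := by nlinarith
    exact_mod_cast this
  have hkq := natCast_mul_log_le (by omega) hq1 hr0 hrn.1 hv hnC
  have hkq' := mul_log_sub_one_le (by omega) hq1 hrpos (by linarith) hv
  have hlq : 0 < Real.log (q n) := Real.log_pos (by exact_mod_cast hq1)
  have ht := natCast_clog_le (by omega) hln1
  set t := Nat.clog 2 (n ^ 4) with htdef
  have htk : t ≤ k n := by
    have : (t : ℝ) ≤ k n := by nlinarith
    exact_mod_cast this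
  obtain ⟨m, hm⟩ := Nat.exists_eq_add_of_le' htk
  have hβ0 : 0 < β := by
    have : (1 : ℝ) ≤ k n := by exact_mod_cast hkpos
    by_contra hneg
    nlinarith
  have hβq : Real.log n - 1 ≤ β * Real.log (q n) := by
    refine le_of_mul_le_mul_left ?_ hn0
    calc _ ≤ _ := hkq'
      _ ≤ β * n * Real.log (q n) := by gcongr
      _ = _ := by ring
  have hgrid := four_mul_sqrt_le (by omega) hq1 hβ0 (mul_pos hη hr0) hβq
    (by rw [div_le_iff₀ (by linarith)] at hlnβ; linarith)
  have hgrid' : 4 * √n ≤ η * r n * √(q n) := hgrid.trans (by gcongr; exact hrn.1.le)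
  have hqt := pow_clog_le hη hkpos hkq hq1 ht (by omega) hlkη
  have hpow := pow_lt_mul_two_pow_two_pow_clog hn hkpos hq1 hkq
  have hdev := generatorLaw_deviation_le (m := m) (t := t) (by omega) (σ n) (hϱ n) hrpos hη
    (hm ▸ hv) (by nlinarith) hgrid' hpow
  rw [← hm] at hdev
  refine (measure_mono fun G hG => ?_).trans (hdev.trans (ENNReal.ofReal_le_ofReal ?_))
  · exact hηε.trans_le hG
  -- Half of the exponent `2n` pays for `q^t`; the other half gives the decay.
  · have h1 : (q n : ℝ) ^ t / (1 + η) ^ (2 * n) ≤ ((1 + η)⁻¹) ^ n := by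
      rw [div_le_iff₀ (by positivity), two_mul, pow_add, ← mul_assoc, ← mul_pow,
        inv_mul_cancel₀ (by positivity), one_pow, one_mul]
      exact hqt
    calc _ = 2 * ((n : ℝ) * ((q n : ℝ) ^ t / (1 + η) ^ (2 * n))) + t / n := by ring
      _ ≤ 2 * ((n : ℝ) * ((1 + η)⁻¹) ^ n) + 7 * Real.log n / n := by gcongr
      _ = _ := by ring
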